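/- **Setting.** Let $F$ be a rational ruled surface in $\mathbb R^3$, given by $f(u,v)=c(u)+v\,e(u)$ with $c,e\in\mathbb R(u)^3$, and assume that $F$ is non-developable, i.e. the vectors $\dot c\times e$ and $\dot e\times e$ are not linearly dependent for all $u$. At regular points let $n=(f_u\times f_v)/\|f_u\times f_v\|$. For $d\in\mathbb R$ the offset $F_d$ is the surface $f_d=f+d\,n$. Let $O\in\mathbb R^3$ be any point. The pedal surface $G_d$ of $F_d$ with respect to $O$ is the Zariski closure in $\mathbb R^3$ of the set of foot-points of the perpendiculars from $O$ to the tangent planes of $F_d$ (at the regular points of $f_d$ over regular points of $f$); $G=G_0$ is the pedal surface of $F$. The conchoid at distance $d$ with respect to $O$ of a set $S$ (a surface, or a curve in a plane through $O$) is the Zariski closure of the set of points $Q$ that lie on a line $OP$ with $P\in S$, $P\ne O$, and satisfy $|QP|=|d|$. **Proposition.** For every point $O$ the following hold. 1. There are rational functions $r(u,t)$ and $s(u,t)=(s_1,s_2,s_3)(u,t)$ over $\mathbb R$ such that $\|s\|=1$, $s$ is a rational parametrization of the unit sphere $S^2$ (its image is Zariski dense in $S^2$), and for every $d\in\mathbb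 R$ the map $O+(r(u,t)+d)\,s(u,t)$ is a rational parametrization of $G_d$ (the Zariski closure of its image is $G_d$). That is, the surfaces $G_d$ admit rational polar representations with respect to $O$. 2. There are $m\in\mathbb R(u)^3$, $q\in\mathbb R(u)$ and a finite set $T\subset\mathbb R$ such that for all $u\notin T$: the functions $c,e,m,q$ have no pole at $u$, $e(u)\ne0$, $q(u)>0$, and the circle $C(u)$ with centre $m(u)$ and radius $\sqrt{q(u)}$ in the plane through $O$ perpendicular to the ruling $l(u)$ (this plane contains $m(u)$) is the closure of the set of foot-points from $O$ on the tangent planes of $F$ along $l(u)$. Moreover $G$ is generated by these circles: $G$ is the Zariski closure of $\bigcup_{u\notin T}C(u)$. 3. With the same circles, for every $d\in\mathbb R$: for each $u\notin T$ the planar conchoid of $C(u)$ at distance $d$ with respect to $O$ is the Zariski closure of the set of foot-points from $O$ on the tangent planes of $F_d$ at the points $f_d(u,v)$, $v\in\mathbb R$, and $G_d$ is generated by these planar conchoids, i.e. it is the Zariski closure of their union over $u\notin T$. The surface $G_d$ is the conchoid surface of $G$ at distance $d$ with respect to $O$. -/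

import Mathlib

noncomputable section

namespace RuledPedal

/-- Euclidean three-space. -/
abbrev E3 : Type := EuclideanSpace ℝ (Fin 3)

/-- The vector product in Euclidean three-space. -/
def cross (x y : E3) : E3 := WithLp.toLp 2 (crossProduct x.ofLp y.ofLp)

/-- The (real) Zariski closure of a subset of three-space: the common zeros of all real
polynomials that vanish on it. -/
def zariskiClosure (S : Set E3) : Set E3 :=
  {x | ∀ p : MvPolynomial (Fin 3) ℝ,
    (∀ y ∈ S, MvPolynomial.eval (fun i => y i) p = 0) →
      MvPolynomial.eval (fun i => x i) p = 0}

/-! ### Rational functions -/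

/-- A rational function of two real variables, as a fraction of polynomials. -/
structure RatFun2 where
  num : MvPolynomial (Fin 2) ℝ
  den : MvPolynomial (Fin 2) ℝ
  den_ne_zero : den ≠ 0

namespace RatFun2

def IsDefinedAt (h : RatFun2) (a : Fin 2 → ℝ) : Prop := MvPolynomial.eval a h.den ≠ 0

def val (h : RatFun2) (a : Fin 2 → ℝ) : ℝ :=
  MvPolynomial.eval a h.num / MvPolynomial.eval a h.den

/-- The rational function `h + d` for a constant `d`. -/
def addConst (h : RatFun2) (d : ℝ) : RatFun2 where
  num := h.num + MvPolynomial.C d * h.den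
  den := h.den
  den_ne_zero := h.den_ne_zero

end RatFun2

/-- The value of a triple of rational functions of two variables. -/
def val3 (s : Fin 3 → RatFun2) (a : Fin 2 → ℝ) : E3 := WithLp.toLp 2 fun i => (s i).val a

/-- `u` is not a pole of the rational function `h` of one variable. -/
def IsDefinedAt (h : RatFunc ℝ) (u : ℝ) : Prop := h.denom.eval u ≠ 0

/-- The point with parameter `u` of the rational space curve with coordinate functions `c`. -/
def curveAt (c : Fin 3 → RatFunc ℝ) (u : ℝ) : E3 :=
  WithLp.toLp 2 fun i => (c i).eval (RingHom.id ℝ) u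

/-! ### Parametrized surfaces, offsets, tangent planes, pedal surfaces -/

/-- The partial derivatives of `f` at `p` are linearly independent. (This forces
differentiability, since `fderiv` is zero otherwise.) -/
def IsRegularAt (f : ℝ × ℝ → E3) (p : ℝ × ℝ) : Prop :=
  LinearIndependent ℝ ![fderiv ℝ f p (1, 0), fderiv ℝ f p (0, 1)]

/-- The unit normal vector `(f_u × f_v) / ‖f_u × f_v‖` of a parametrized surface at a regular
point. -/
def unitNormal (f : ℝ × ℝ → E3) (p : ℝ × ℝ) : E3 :=
  ‖cross (fderiv ℝ f p (1, 0)) (fderiv ℝ f p (0, 1))‖⁻¹ •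
    cross (fderiv ℝ f p (1, 0)) (fderiv ℝ f p (0, 1))

/-- The one-sided offset `f_d = f + d n` at oriented distance `d`. -/
def offset (f : ℝ × ℝ → E3) (d : ℝ) (p : ℝ × ℝ) : E3 := f p + d • unitNormal f p

/-- The tangent plane at a regular point. -/
def tangentPlane (f : ℝ × ℝ → E3) (p : ℝ × ℝ) : AffineSubspace ℝ E3 :=
  AffineSubspace.mk' (f p) (Submodule.span ℝ {fderiv ℝ f p (1, 0), fderiv ℝ f p (0, 1)})

/-- `P` is the foot-point on the plane `A` of the perpendicular through `O`. -/
def IsFootPoint (O : E3) (A : AffineSubspace ℝ E3) (P : E3) : Prop :=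
  P ∈ A ∧ ∀ x ∈ A, inner ℝ (P - O) (x - P) = 0

/-- The foot-points, with respect to `O`, on the tangent planes of the surface `f` at its regular
points with parameters in `D`. -/
def pedalSet (O : E3) (f : ℝ × ℝ → E3) (D : Set (ℝ × ℝ)) : Set E3 :=
  {P | ∃ p ∈ D, IsRegularAt f p ∧ IsFootPoint O (tangentPlane f p) P}

/-- The pedal surface, as an algebraic set. -/
def pedalSurface (O : E3) (f : ℝ × ℝ → E3) (D : Set (ℝ × ℝ)) : Set E3 :=
  zariskiClosure (pedalSet O f D)

/-! ### Conchoids and rational polar representations -/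

/-- The conchoid of `S` with respect to `O` at distance `|d|`: the Zariski closure of the set of
points `Q` on the lines `OP`, `P ∈ S`, with `|QP| = |d|`. It is used for surfaces and for planar
curves whose plane contains `O`. -/
def conchoid (O : E3) (d : ℝ) (S : Set E3) : Set E3 :=
  zariskiClosure {Q | ∃ P ∈ S, P ≠ O ∧ Q ∈ affineSpan ℝ {O, P} ∧ dist Q P = |d|}

/-- `O + r(a) s(a)` is a rational polar representation of `G` with respect to `O`: `s` is a
rational parametrization of the unit sphere and `O + r s` is a rational parametrization
of `G`. -/
def IsRationalPolarRepresentation (O : E3) (r : RatFun2) (s : Fin 3 → RatFun2)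
    (G : Set E3) : Prop :=
  (∀ a, (∀ i, (s i).IsDefinedAt a) → ‖val3 s a‖ = 1) ∧
  zariskiClosure {x | ∃ a, (∀ i, (s i).IsDefinedAt a) ∧ x = val3 s a} = Metric.sphere 0 1 ∧
  zariskiClosure {x | ∃ a, (∀ i, (s i).IsDefinedAt a) ∧ r.IsDefinedAt a ∧
    x = O + r.val a • val3 s a} = G

/-- The circle with centre `m` and squared radius `q` in the plane through `m` with normal
vector `e`. -/
def circle (m : E3) (q : ℝ) (e : E3) : Set E3 :=
  {x | ‖x - m‖ ^ 2 = q ∧ inner ℝ (x - m) e = 0}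

/-! ### Rational ruled surfaces -/

/-- The parametrization `c(u) + v e(u)`. -/
def ruled (c e : Fin 3 → RatFunc ℝ) (p : ℝ × ℝ) : E3 :=
  curveAt c p.1 + p.2 • curveAt e p.1

/-- The parameters `u` at which neither `c` nor `e` has a pole. -/
def ruledBase (c e : Fin 3 → RatFunc ℝ) : Set ℝ :=
  {u | ∀ i, IsDefinedAt (c i) u ∧ IsDefinedAt (e i) u}

/-- The parameters of the regular points of `c(u) + v e(u)`. -/
def ruledDomain (c e : Fin 3 → RatFunc ℝ) : Set (ℝ × ℝ) :=
  {p | p.1 ∈ ruledBase c e ∧ IsRegularAt (ruled c e) p}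

/-- The part of `ruledDomain` that belongs to the generating line with parameter `u`. -/
def rulingDomain (c e : Fin 3 → RatFunc ℝ) (u : ℝ) : Set (ℝ × ℝ) :=
  {p | p ∈ ruledDomain c e ∧ p.1 = u}

/-- The ruled surface `c(u) + v e(u)` is developable: the vectors `c' × e` and `e' × e`
are linearly dependent for all `u`. -/
def IsDevelopable (c e : Fin 3 → RatFunc ℝ) : Prop :=
  ∀ u ∈ ruledBase c e, ¬ LinearIndependent ℝ
    ![cross (deriv (curveAt c) u) (curveAt e u), cross (deriv (curveAt e) u) (curveAt e u)]

end RuledPedal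

end

open Filter Topology Polynomial

namespace RuledPedal

/-! ### The vector product -/

/-! Fix a ruling `u`. The normals of F along it form the pencil a + v b with a = c' × e and b = e' ×
e, both orthogonal to e. Non-developability makes a and b independent at one parameter, hence by
rationality at almost all, and the pencil then spans the plane orthogonal to e. Where the offset is
regular, its tangent plane is parallel to that of F, because the derivatives of a unit field are
orthogonal to it. As e is orthogonal to n, the foot-point is O + (h(n) + d) n with h(n) = ⟨c - O, n⟩
(`isFootPoint_offset_iff`). Everything thus reduces to the maps n ↦ O + (h(n) + d) n on the great
circles orthogonal to e(u).

For d = 0 the image is the Thales circle over the segment from O to its projection along the ruling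
(`footCurve_zero_eq_circle`). It is a proper circle for almost all u, since otherwise F would be a
cone with vertex O. For general d the foot-point is moved by d along the line through O; n and -n
give the two conchoid points, so the image has the same Zariski closure as the conchoid of the
circle. The regular points need not reach all n, but a polynomial composed with the foot-point map
is analytic, so infinitely many n determine the closure (`footCurve_subset_zariskiClosure`).
Exceptional rulings add only limits of good ones (`pedalSurface_offset_eq`), and conchoids are
compatible with Zariski closure because a polynomial pulled back along the transformation has the
form a + l b with l the signed distance (`exists_conchoid_pullback`).

The polar representation needs a rational unit field orthogonal to e. It exists because |e|², after
clearing denominators, is a sum of two polynomial squares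
(`exists_orthogonal_with_polynomial_length`); turning this field about e with a rational half-angle
parameter yields s, and r = h(s) is independent of d. Density in the sphere follows because the
great circles move: e' × e ≠ 0 (`eq_zero_on_sphere`). -/

theorem inner_eq (x y : E3) : inner ℝ x y = x 0 * y 0 + x 1 * y 1 + x 2 * y 2 := by
  simp [PiLp.inner_apply, Fin.sum_univ_three, mul_comm]

theorem norm_sq_eq (x : E3) : ‖x‖ ^ 2 = x 0 ^ 2 + x 1 ^ 2 + x 2 ^ 2 := by
  rw [← real_inner_self_eq_norm_sq, inner_eq]; ring

@[simp] theorem cross_apply_zero (x y : E3) : cross x y 0 = x 1 * y 2 - x 2 * y 1 := by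
  simp [cross, cross_apply]

@[simp] theorem cross_apply_one (x y : E3) : cross x y 1 = x 2 * y 0 - x 0 * y 2 := by
  simp [cross, cross_apply]

@[simp] theorem cross_apply_two (x y : E3) : cross x y 2 = x 0 * y 1 - x 1 * y 0 := by
  simp [cross, cross_apply]

theorem inner_cross_left (x y : E3) : inner ℝ (cross x y) x = 0 := by
  simp only [inner_eq, cross_apply_zero, cross_apply_one, cross_apply_two]; ring

theorem inner_cross_right (x y : E3) : inner ℝ (cross x y) y = 0 := by
  simp only [inner_eq, cross_apply_zero, cross_apply_one, cross_apply_two]; ring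

theorem norm_cross_sq (x y : E3) :
    ‖cross x y‖ ^ 2 = ‖x‖ ^ 2 * ‖y‖ ^ 2 - inner ℝ x y ^ 2 := by
  simp only [norm_sq_eq, inner_eq, cross_apply_zero, cross_apply_one, cross_apply_two]; ring

theorem linearIndependent_pair_iff_cross {x y : E3} :
    LinearIndependent ℝ ![x, y] ↔ cross x y ≠ 0 := by
  have h := crossProduct_ne_zero_iff_linearIndependent (v := x.ofLp) (w := y.ofLp)
  have h2 : ![x.ofLp, y.ofLp] = (WithLp.linearEquiv 2 ℝ (Fin 3 → ℝ)).toLinearMap ∘ ![x, y] := by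
    ext i j; fin_cases i <;> rfl
  rw [h2, LinearMap.linearIndependent_iff _ (LinearEquiv.ker _)] at h
  rw [← h, cross, not_iff_not]
  constructor
  · intro h; rw [h]; rfl
  · intro h; simpa using congrArg WithLp.ofLp h

theorem cross_add_left (x y z : E3) : cross (x + y) z = cross x z + cross y z := by
  simp [cross]

theorem cross_smul_left (k : ℝ) (x z : E3) : cross (k • x) z = k • cross x z := by
  simp [cross]

theorem cross_self (x : E3) : cross x x = 0 := by
  simp [cross]

/-- Two independent vectors orthogonal to `e ≠ 0` span the plane orthogonal to `e`. -/
theorem span_pair_eq_orthogonal {a b e : E3} (hab : LinearIndependent ℝ ![a, b]) (he : e ≠ 0)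
    (ha : inner ℝ a e = 0) (hb : inner ℝ b e = 0) :
    Submodule.span ℝ {a, b} = (Submodule.span ℝ {e})ᗮ := by
  have : Fact (Module.finrank ℝ E3 = 2 + 1) := ⟨by simp⟩
  apply Submodule.eq_of_le_of_finrank_eq
  · rw [Submodule.span_le]
    rintro x (rfl | rfl)
    · exact Submodule.mem_orthogonal_singleton_iff_inner_left.2 ha
    · exact Submodule.mem_orthogonal_singleton_iff_inner_left.2 hb
  · rw [Submodule.finrank_orthogonal_span_singleton (n := 2) he]
    have := finrank_span_eq_card hab
    rwa [Matrix.range_cons_cons_empty, Fintype.card_fin] at this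

theorem exists_combination_of_inner_eq_zero {a b e n : E3} (hab : LinearIndependent ℝ ![a, b])
    (he : e ≠ 0) (ha : inner ℝ a e = 0) (hb : inner ℝ b e = 0) (hn : inner ℝ n e = 0) :
    ∃ α β : ℝ, α • a + β • b = n := by
  rw [← Submodule.mem_span_pair, span_pair_eq_orthogonal hab he ha hb]
  exact Submodule.mem_orthogonal_singleton_iff_inner_left.2 hn

/-! ### Zariski closures -/

theorem subset_zariskiClosure (S : Set E3) : S ⊆ zariskiClosure S := fun _ hx _ hp => hp _ hx

theorem zariskiClosure_subset_iff {S S' : Set E3} :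
    zariskiClosure S ⊆ zariskiClosure S' ↔ S ⊆ zariskiClosure S' :=
  ⟨(subset_zariskiClosure S).trans, fun h _ hx p hp => hx p fun _ hy => h hy p hp⟩

theorem zariskiClosure_mono {S S' : Set E3} (h : S ⊆ S') :
    zariskiClosure S ⊆ zariskiClosure S' :=
  zariskiClosure_subset_iff.2 (h.trans (subset_zariskiClosure S'))

theorem continuous_eval (p : MvPolynomial (Fin 3) ℝ) :
    Continuous fun x : E3 => MvPolynomial.eval (fun i => x i) p :=
  (MvPolynomial.continuous_eval p).comp (by fun_prop)

theorem analyticOnNhd_eval (p : MvPolynomial (Fin 3) ℝ) :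
    AnalyticOnNhd ℝ (fun x : E3 => MvPolynomial.eval (fun i => x i) p) Set.univ := by
  have := AnalyticOnNhd.aeval_mvPolynomial (𝕜 := ℝ) (A := ℝ) (B := ℝ) (s := Set.univ)
    (f := fun (x : E3) (i : Fin 3) => x i)
    (fun i => (EuclideanSpace.proj (𝕜 := ℝ) i : E3 →L[ℝ] ℝ).analyticOnNhd _) p
  simpa [MvPolynomial.aeval_eq_eval] using this

/-- A punctured limit of points of a Zariski closed set belongs to that set. -/
theorem mem_zariskiClosure_of_eventually {S : Set E3} {g : ℝ → E3} {u : ℝ}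
    (hg : ContinuousAt g u) (h : ∀ᶠ x in 𝓝[≠] u, g x ∈ zariskiClosure S) :
    g u ∈ zariskiClosure S := by
  intro p hp
  have h1 : Tendsto (fun x => MvPolynomial.eval (fun i => g x i) p) (𝓝[≠] u)
      (𝓝 (MvPolynomial.eval (fun i => g u i) p)) :=
    (((continuous_eval p).continuousAt (x := g u)).tendsto.comp hg.tendsto).mono_left
      nhdsWithin_le_nhds
  have h2 : Tendsto (fun x => MvPolynomial.eval (fun i => g x i) p) (𝓝[≠] u) (𝓝 0) :=
    tendsto_const_nhds.congr' (h.mono fun x hx => (hx p hp).symm)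
  exact tendsto_nhds_unique h1 h2

/-! ### Identity principle on great circles -/

theorem exists_angle {α β : ℝ} (h : α ^ 2 + β ^ 2 = 1) :
    ∃ θ ∈ Set.Icc (-Real.pi) Real.pi, α = Real.cos θ ∧ β = Real.sin θ := by
  set z : ℂ := ⟨α, β⟩ with hz
  have hn : ‖z‖ = 1 := by
    have : ‖z‖ ^ 2 = 1 := by rw [Complex.sq_norm, Complex.normSq_apply]; simp [hz]; linarith
    exact (pow_eq_one_iff_of_nonneg (norm_nonneg z) two_ne_zero).1 this
  refine ⟨z.arg, ⟨(Complex.neg_pi_lt_arg z).le, Complex.arg_le_pi z⟩, ?_, ?_⟩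
  · have := Complex.norm_mul_cos_arg z
    rw [hn, one_mul] at this; exact this.symm
  · have := Complex.norm_mul_sin_arg z
    rw [hn, one_mul] at this; exact this.symm

theorem exists_orthonormal_frame {e : E3} (he : e ≠ 0) :
    ∃ a b : E3, ‖a‖ = 1 ∧ ‖b‖ = 1 ∧ inner ℝ a b = 0 ∧ inner ℝ a e = 0 ∧ inner ℝ b e = 0 := by
  have : Fact (Module.finrank ℝ E3 = 2 + 1) := ⟨by simp⟩
  let B := OrthonormalBasis.fromOrthogonalSpanSingleton (𝕜 := ℝ) 2 he
  refine ⟨B 0, B 1, B.orthonormal.1 0, B.orthonormal.1 1, B.orthonormal.2 (by decide), ?_, ?_⟩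
  · exact Submodule.mem_orthogonal_singleton_iff_inner_left.1 (B 0).2
  · exact Submodule.mem_orthogonal_singleton_iff_inner_left.1 (B 1).2

theorem norm_combination_sq {a b : E3} (ha : ‖a‖ = 1) (hb : ‖b‖ = 1) (hab : inner ℝ a b = 0)
    (α β : ℝ) : ‖α • a + β • b‖ ^ 2 = α ^ 2 + β ^ 2 := by
  rw [norm_add_sq_real, norm_smul, norm_smul, ha, hb, inner_smul_left, inner_smul_right, hab]
  simp

/-- An analytic function that vanishes at infinitely many points of a great circle vanishes on the
whole circle. -/
theorem eq_zero_on_great_circle {F : E3 → ℝ} (hF : AnalyticOnNhd ℝ F Set.univ) {e : E3}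
    (he : e ≠ 0) {Z : Set E3} (hZ : Z.Infinite)
    (hZe : ∀ n ∈ Z, ‖n‖ = 1 ∧ inner ℝ n e = 0 ∧ F n = 0) {n : E3} (hn : ‖n‖ = 1)
    (hne : inner ℝ n e = 0) : F n = 0 := by
  obtain ⟨a, b, ha, hb, hab, hae, hbe⟩ := exists_orthonormal_frame he
  have hli : LinearIndependent ℝ ![a, b] := by
    rw [linearIndependent_pair_iff_cross]
    intro h
    have := norm_cross_sq a b
    rw [h, ha, hb, hab] at this
    norm_num at this
  set k : ℝ → E3 := fun θ => Real.cos θ • a + Real.sin θ • b with hk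
  have hpar : ∀ n : E3, ‖n‖ = 1 → inner ℝ n e = 0 → ∃ θ ∈ Set.Icc (-Real.pi) Real.pi, k θ = n := by
    intro n hn hne
    obtain ⟨α, β, rfl⟩ := exists_combination_of_inner_eq_zero hli he hae hbe hne
    have h1 : α ^ 2 + β ^ 2 = 1 := by
      rw [← norm_combination_sq ha hb hab, hn]; norm_num
    obtain ⟨θ, hθ, rfl, rfl⟩ := exists_angle h1
    exact ⟨θ, hθ, rfl⟩
  have hkan : AnalyticOnNhd ℝ k Set.univ := fun θ _ =>
    (Real.analyticAt_cos.smul analyticAt_const).add (Real.analyticAt_sin.smul analyticAt_const)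
  have hFk : AnalyticOnNhd ℝ (fun θ => F (k θ)) Set.univ := hF.comp hkan fun _ _ => trivial
  -- Angles are restricted to a compact interval so that infinitely many of them accumulate; the
  -- identity theorem in the angle then applies.
  have hinf : (Set.Icc (-Real.pi) Real.pi ∩ k ⁻¹' Z).Infinite := by
    refine Set.Infinite.of_image k (hZ.mono fun z hz => ?_)
    obtain ⟨θ, hθ, rfl⟩ := hpar z (hZe z hz).1 (hZe z hz).2.1
    exact ⟨θ, ⟨hθ, hz⟩, rfl⟩
  obtain ⟨θ₀, -, hacc⟩ :=
    hinf.exists_accPt_of_subset_isCompact isCompact_Icc Set.inter_subset_left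
  have hfr : ∃ᶠ θ in 𝓝[≠] θ₀, F (k θ) = 0 :=
    (accPt_iff_frequently_nhdsNE.1 hacc).mono fun θ hθ => (hZe _ hθ.2).2.2
  have hz := hFk.eqOn_zero_of_preconnected_of_frequently_eq_zero isPreconnected_univ
    (Set.mem_univ θ₀) hfr
  obtain ⟨θ, -, rfl⟩ := hpar n hn hne
  exact hz (Set.mem_univ θ)

/-- The foot-point of `O` on the plane with unit normal `n` at oriented distance `d` from the
parallel plane through `c`. -/
noncomputable def footAt (O c : E3) (d : ℝ) (n : E3) : E3 := O + (inner ℝ (c - O) n + d) • n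

/-- The support function is odd in the normal. Reversing n therefore trades d for -d, which produces
the second conchoid point on each line and makes the sign of n irrelevant for d = 0. -/
theorem footAt_neg (O c : E3) (d : ℝ) (n : E3) : footAt O c d (-n) = footAt O c (-d) n := by
  simp only [footAt, inner_neg_right, smul_neg, ← neg_smul]; congr 2; ring

theorem analyticOnNhd_footAt (O c : E3) (d : ℝ) : AnalyticOnNhd ℝ (footAt O c d) Set.univ := by
  have h : AnalyticOnNhd ℝ (fun n : E3 => inner ℝ (c - O) n) Set.univ :=
    (innerSL ℝ (c - O)).analyticOnNhd _
  intro n _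
  exact analyticAt_const.add (((h n trivial).add analyticAt_const).smul analyticAt_id)

theorem continuous_footAt (O c : E3) (d : ℝ) : Continuous (footAt O c d) := by
  unfold footAt; fun_prop

/-- All the points `footAt O c d n`, for the unit vectors `n` orthogonal to `e`. -/
def footCurve (O c e : E3) (d : ℝ) : Set E3 :=
  {x | ∃ n : E3, ‖n‖ = 1 ∧ inner ℝ n e = 0 ∧ x = footAt O c d n}

/-- A polynomial composed with the foot-point map is analytic in n, so its vanishing at infinitely
many points of the great circle propagates to the whole circle. This removes the need to know which
normals occur at regular points. -/
theorem footCurve_subset_zariskiClosure {O c e : E3} {d : ℝ} (he : e ≠ 0) {Z : Set E3}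
    (hZ : Z.Infinite) (hZe : ∀ n ∈ Z, ‖n‖ = 1 ∧ inner ℝ n e = 0) {S : Set E3}
    (hS : ∀ n ∈ Z, footAt O c d n ∈ zariskiClosure S) :
    footCurve O c e d ⊆ zariskiClosure S := by
  rintro x ⟨n, hn, hne, rfl⟩ p hp
  refine eq_zero_on_great_circle (F := fun n => MvPolynomial.eval (fun i => footAt O c d n i) p)
    ?_ he hZ (fun n hn => ⟨(hZe n hn).1, (hZe n hn).2, hS n hn p hp⟩) hn hne
  exact (analyticOnNhd_eval p).comp (analyticOnNhd_footAt O c d) fun _ _ => trivial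

/-! ### Nonnegative real polynomials are sums of two squares -/

theorem eval_nonneg_of_ne {h : ℝ[X]} {x : ℝ} (hh : ∀ y, y ≠ x → 0 ≤ h.eval y) (y : ℝ) :
    0 ≤ h.eval y := by
  have hcl : IsClosed {y | 0 ≤ h.eval y} := isClosed_le continuous_const h.continuous
  have hsub : closure {x}ᶜ ⊆ {y | 0 ≤ h.eval y} := closure_minimal (fun y hy => hh y hy) hcl
  rw [(dense_compl_singleton x).closure_eq] at hsub
  exact hsub (Set.mem_univ y)

/-- A root of a nonnegative polynomial is a minimum, so the derivative vanishes there too and the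
root is double. -/
theorem exists_eq_sq_mul_of_nonneg_of_isRoot {p : ℝ[X]} (hp : ∀ x, 0 ≤ p.eval x) {x : ℝ}
    (hx : p.eval x = 0) : ∃ h : ℝ[X], p = (X - C x) ^ 2 * h ∧ ∀ y, 0 ≤ h.eval y := by
  obtain ⟨g, rfl⟩ := dvd_iff_isRoot.2 hx
  have hmin : IsLocalMin (fun y => ((X - C x) * g).eval y) x :=
    Eventually.of_forall fun y => by simpa using hp y
  have hd := hmin.hasDerivAt_eq_zero (((X - C x) * g).hasDerivAt x)
  have hg : g.eval x = 0 := by simpa using hd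
  obtain ⟨h, rfl⟩ := dvd_iff_isRoot.2 hg
  refine ⟨h, by ring, eval_nonneg_of_ne (x := x) fun y hy => ?_⟩
  have h1 := hp y
  rw [← mul_assoc, ← sq, eval_mul] at h1
  refine nonneg_of_mul_nonneg_right h1 ?_
  have := sub_ne_zero.2 hy
  simp only [eval_pow, eval_sub, eval_X, eval_C]
  positivity

/-- Induction on the degree: a quadratic factor that is a sum of two squares is split off, and the
two-square identity recombines it with the quotient. -/
theorem exists_eq_sq_add_sq_of_nonneg (p : ℝ[X]) (hp : ∀ x, 0 ≤ p.eval x) :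
    ∃ a b : ℝ[X], p = a ^ 2 + b ^ 2 := by
  induction hn : p.natDegree using Nat.strong_induction_on generalizing p with
  | _ n ih =>
    by_cases h0 : p.natDegree = 0
    · obtain ⟨r, rfl⟩ := natDegree_eq_zero.1 h0
      have hr : 0 ≤ r := by simpa using hp 0
      exact ⟨C (Real.sqrt r), 0, by rw [← C_pow, Real.sq_sqrt hr]; simp⟩
    have hp0 : p ≠ 0 := by rintro rfl; simp at h0
    obtain ⟨z, hz⟩ := IsAlgClosed.exists_aeval_eq_zero ℂ p
      (fun h => h0 (natDegree_eq_of_degree_eq_some h))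
    have key : ∀ a b h : ℝ[X], p = (a ^ 2 + b ^ 2) * h → (a ^ 2 + b ^ 2).natDegree = 2 →
        (∀ y, 0 ≤ h.eval y) → ∃ a b : ℝ[X], p = a ^ 2 + b ^ 2 := by
      intro a b h hph hdeg hh
      have hne : (a ^ 2 + b ^ 2) * h ≠ 0 := hph ▸ hp0
      obtain ⟨a', b', hab⟩ := ih h.natDegree (by
        rw [← hn, hph, natDegree_mul (left_ne_zero_of_mul hne) (right_ne_zero_of_mul hne), hdeg]
        omega) h hh rfl
      exact ⟨a * a' - b * b', a * b' + b * a', by rw [hph, hab]; ring⟩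
    -- A complex root z contributes the factor (X - Re z)² + (Im z)²; for a real root the second
    -- square is zero and the root is double.
    by_cases him : z.im = 0
    · have hx : p.eval z.re = 0 := by
        have hz' : z = ((z.re : ℝ) : ℂ) := Complex.ext (by simp) (by simp [him])
        rw [hz', ← Complex.coe_algebraMap, aeval_algebraMap_apply] at hz
        simpa using hz
      obtain ⟨h, hph, hh⟩ := exists_eq_sq_mul_of_nonneg_of_isRoot hp hx
      exact key (X - C z.re) 0 h (by rw [hph]; ring) (by simp) hh
    · obtain ⟨h, hph⟩ := p.quadratic_dvd_of_aeval_eq_zero_im_ne_zero hz him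
      have hq : X ^ 2 - C (2 * z.re) * X + C (‖z‖ ^ 2) = (X - C z.re) ^ 2 + (C z.im) ^ 2 := by
        rw [Complex.sq_norm, Complex.normSq_apply]
        simp only [C_mul, C_add, C_ofNat]; ring
      rw [hq] at hph
      refine key _ _ h hph ?_ fun y => ?_
      · rw [← C_pow, natDegree_add_C]; simp
      · have h1 := hp y
        rw [hph] at h1
        simp only [eval_mul, eval_add, eval_pow, eval_sub, eval_X, eval_C] at h1
        exact nonneg_of_mul_nonneg_right h1 (by positivity)

/-- A polynomial vector field in three-space admits an orthogonal polynomial vector field whose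
length is a polynomial. -/
theorem exists_orthogonal_with_polynomial_length (Q : Fin 3 → ℝ[X]) :
    ∃ (N : Fin 3 → ℝ[X]) (ω : ℝ[X]), ω ≠ 0 ∧
      N 0 ^ 2 + N 1 ^ 2 + N 2 ^ 2 = ω ^ 2 ∧ N 0 * Q 0 + N 1 * Q 1 + N 2 * Q 2 = 0 := by
  obtain ⟨α, β, hσ⟩ := exists_eq_sq_add_sq_of_nonneg (Q 0 ^ 2 + Q 1 ^ 2 + Q 2 ^ 2) fun x => by
    simp only [eval_add, eval_pow]; positivity
  -- The vectors Q and (α, β, 0) have equal length, so the reflection along W = Q - (α, β, 0)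
  -- exchanges them. It carries e₃, which is orthogonal to (α, β, 0), to a unit vector orthogonal to
  -- Q. Clearing the denominator ω = |W|² gives N = ω e₃ - 2 Q₂ W of length |ω|. If W = 0, then Q₂ =
  -- 0 and e₃ itself serves.
  by_cases hω : (Q 0 - α) ^ 2 + (Q 1 - β) ^ 2 + Q 2 ^ 2 = 0
  · have hQ : Q 2 = 0 := by
      refine Polynomial.funext fun x => ?_
      have := congrArg (eval x) hω
      simp only [eval_add, eval_pow, eval_zero, eval_sub] at this ⊢
      nlinarith [sq_nonneg ((Q 0).eval x - α.eval x), sq_nonneg ((Q 1).eval x - β.eval x),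
        sq_nonneg ((Q 2).eval x)]
    exact ⟨![0, 0, 1], 1, one_ne_zero, by simp, by simp [hQ]⟩
  · set ω := (Q 0 - α) ^ 2 + (Q 1 - β) ^ 2 + Q 2 ^ 2 with hωd
    refine ⟨![- 2 * Q 2 * (Q 0 - α), - 2 * Q 2 * (Q 1 - β), ω - 2 * Q 2 * Q 2], ω, hω, ?_, ?_⟩
    · simp only [Matrix.cons_val_zero, Matrix.cons_val_one, Matrix.cons_val]
      linear_combination (-4 * Q 2 ^ 2) * hωd
    · simp only [Matrix.cons_val_zero, Matrix.cons_val_one, Matrix.cons_val]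
      linear_combination Q 2 * hωd - Q 2 * hσ

/-! ### Functions that are rational up to finitely many values -/

theorem eventually_eval_ne_zero {p : ℝ[X]} (hp : p ≠ 0) : ∀ᶠ u in cofinite, p.eval u ≠ 0 := by
  simpa [eventually_cofinite, IsRoot] using finite_setOfPred_isRoot hp

theorem eventually_isDefinedAt (h : RatFunc ℝ) : ∀ᶠ u in cofinite, IsDefinedAt h u :=
  eventually_eval_ne_zero h.denom_ne_zero

theorem IsDefinedAt.eval₂_ne_zero {h : RatFunc ℝ} {u : ℝ} (hu : IsDefinedAt h u) :
    h.denom.eval₂ (RingHom.id ℝ) u ≠ 0 := hu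

theorem ratFunc_eval_eq (h : RatFunc ℝ) (u : ℝ) :
    h.eval (RingHom.id ℝ) u = h.num.eval u / h.denom.eval u := rfl

theorem eventually_eventually_nhds {P : ℝ → Prop} (h : ∀ᶠ u in cofinite, P u) :
    ∀ᶠ u in cofinite, ∀ᶠ x in 𝓝 u, P x := by
  have hopen : IsOpen {x | ¬ P x}ᶜ := (Set.Finite.isClosed h).isOpen_compl
  filter_upwards [h] with u hu
  filter_upwards [hopen.mem_nhds (x := u) (by simpa using hu)] with x hx
  simpa using hx

theorem eventually_nhdsNE_of_cofinite {P : ℝ → Prop} (h : ∀ᶠ u in cofinite, P u) (u : ℝ) :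
    ∀ᶠ x in 𝓝[≠] u, P x := nhdsNE_le_cofinite u h

theorem exists_finite_of_eventually_cofinite {P : ℝ → Prop} (h : ∀ᶠ u in cofinite, P u) :
    ∃ T : Set ℝ, T.Finite ∧ ∀ u, u ∉ T → P u :=
  ⟨_, h, fun _ hu => not_not.1 hu⟩

/-- `g` agrees with a rational function off a finite set. -/
def IsRational (g : ℝ → ℝ) : Prop :=
  ∃ h : RatFunc ℝ, ∀ᶠ u in cofinite, g u = h.eval (RingHom.id ℝ) u

namespace IsRational

theorem ratFunc (h : RatFunc ℝ) : IsRational fun u => h.eval (RingHom.id ℝ) u :=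
  ⟨h, Eventually.of_forall fun _ => rfl⟩

theorem const (r : ℝ) : IsRational fun _ => r := ⟨RatFunc.C r, by simp⟩

theorem polynomial (p : ℝ[X]) : IsRational fun u => p.eval u :=
  ⟨algebraMap ℝ[X] (RatFunc ℝ) p, Eventually.of_forall fun u => by
    simp [RatFunc.eval_algebraMap, eval₂_eq_eval_map]⟩

theorem congr {g g' : ℝ → ℝ} (hg : IsRational g) (h : ∀ᶠ u in cofinite, g' u = g u) :
    IsRational g' := by
  obtain ⟨k, hk⟩ := hg
  exact ⟨k, by filter_upwards [hk, h] with u h1 h2; rw [h2, h1]⟩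

theorem add {g g' : ℝ → ℝ} (hg : IsRational g) (hg' : IsRational g') :
    IsRational fun u => g u + g' u := by
  obtain ⟨k, hk⟩ := hg
  obtain ⟨k', hk'⟩ := hg'
  refine ⟨k + k', ?_⟩
  filter_upwards [hk, hk', eventually_isDefinedAt k, eventually_isDefinedAt k'] with u h1 h2 h3 h4
  rw [h1, h2, RatFunc.eval_add _ _ h3.eval₂_ne_zero h4.eval₂_ne_zero]

theorem mul {g g' : ℝ → ℝ} (hg : IsRational g) (hg' : IsRational g') :
    IsRational fun u => g u * g' u := by
  obtain ⟨k, hk⟩ := hg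
  obtain ⟨k', hk'⟩ := hg'
  refine ⟨k * k', ?_⟩
  filter_upwards [hk, hk', eventually_isDefinedAt k, eventually_isDefinedAt k'] with u h1 h2 h3 h4
  rw [h1, h2, RatFunc.eval_mul _ _ h3.eval₂_ne_zero h4.eval₂_ne_zero]

theorem sub {g g' : ℝ → ℝ} (hg : IsRational g) (hg' : IsRational g') :
    IsRational fun u => g u - g' u :=
  (hg.add ((const (-1)).mul hg')).congr (Eventually.of_forall fun u => by ring)

theorem pow {g : ℝ → ℝ} (hg : IsRational g) (k : ℕ) : IsRational fun u => g u ^ k := by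
  induction k with
  | zero => simpa using const 1
  | succ k ih => simpa [pow_succ] using ih.mul hg

theorem inv {g : ℝ → ℝ} (hg : IsRational g) : IsRational fun u => (g u)⁻¹ := by
  obtain ⟨k, hk⟩ := hg
  refine ⟨k⁻¹, ?_⟩
  -- For the zero function both inverses are zero by convention; otherwise k · k⁻¹ = 1 can be
  -- evaluated.
  by_cases h0 : k = 0
  · subst h0
    filter_upwards [hk] with u h1
    simp [h1]
  filter_upwards [hk, eventually_isDefinedAt k, eventually_isDefinedAt k⁻¹] with u h1 h2 h3
  have := RatFunc.eval_mul (RingHom.id ℝ) u h2.eval₂_ne_zero h3.eval₂_ne_zero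
  rw [mul_inv_cancel₀ h0, RatFunc.eval_one] at this
  rw [h1]
  exact inv_eq_of_mul_eq_one_right this.symm

theorem div {g g' : ℝ → ℝ} (hg : IsRational g) (hg' : IsRational g') :
    IsRational fun u => g u / g' u := by
  simpa [div_eq_mul_inv] using hg.mul hg'.inv

theorem deriv {g : ℝ → ℝ} (hg : IsRational g) : IsRational (deriv g) := by
  obtain ⟨k, hk⟩ := hg
  refine ((((polynomial k.num.derivative).mul (polynomial k.denom)).sub
    ((polynomial k.num).mul (polynomial k.denom.derivative))).div
      ((polynomial k.denom).pow 2)).congr ?_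
  filter_upwards [eventually_eventually_nhds hk, eventually_isDefinedAt k] with u h1 h2
  rw [EventuallyEq.deriv_eq h1]
  exact ((k.num.hasDerivAt u).div (k.denom.hasDerivAt u) h2).deriv

theorem eventually_eq_zero_or_ne_zero {g : ℝ → ℝ} (hg : IsRational g) :
    (∀ᶠ u in cofinite, g u = 0) ∨ ∀ᶠ u in cofinite, g u ≠ 0 := by
  obtain ⟨k, hk⟩ := hg
  by_cases h0 : k.num = 0
  · left
    filter_upwards [hk] with u h1
    rw [h1, ratFunc_eval_eq, h0]; simp
  · right
    filter_upwards [hk, eventually_eval_ne_zero h0, eventually_isDefinedAt k] with u h1 h2 h3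
    rw [h1, ratFunc_eval_eq]
    exact div_ne_zero h2 h3

/-- A rational function is zero or nonzero off a finite set. The value at `u₀` alone decides
nothing, since `u₀` may be exceptional; continuity carries it to neighbouring parameters. -/
theorem eventually_ne_zero {g : ℝ → ℝ} (hg : IsRational g) {u₀ : ℝ} (hc : ContinuousAt g u₀)
    (h0 : g u₀ ≠ 0) : ∀ᶠ u in cofinite, g u ≠ 0 := by
  refine hg.eventually_eq_zero_or_ne_zero.resolve_left fun h => ?_
  have h1 := eventually_nhdsNE_of_cofinite h u₀
  have h2 := (hc.eventually_ne h0).filter_mono (nhdsWithin_le_nhds (s := {u₀}ᶜ))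
  obtain ⟨u, h3, h4⟩ := (h1.and h2).exists
  exact h4 h3

end IsRational

/-- A space curve whose coordinates are rational up to finitely many values. -/
def IsRationalCurve (g : ℝ → E3) : Prop := ∀ i, IsRational fun u => g u i

namespace IsRationalCurve

theorem curveAt (c : Fin 3 → RatFunc ℝ) : IsRationalCurve (curveAt c) := fun i =>
  IsRational.ratFunc (c i)

theorem const (x : E3) : IsRationalCurve fun _ => x := fun i => IsRational.const (x i)

theorem add {g g' : ℝ → E3} (hg : IsRationalCurve g) (hg' : IsRationalCurve g') :
    IsRationalCurve fun u => g u + g' u := fun i => (hg i).add (hg' i)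

theorem sub {g g' : ℝ → E3} (hg : IsRationalCurve g) (hg' : IsRationalCurve g') :
    IsRationalCurve fun u => g u - g' u := fun i => (hg i).sub (hg' i)

theorem smul {k : ℝ → ℝ} {g : ℝ → E3} (hk : IsRational k) (hg : IsRationalCurve g) :
    IsRationalCurve fun u => k u • g u := fun i => hk.mul (hg i)

theorem inner {g g' : ℝ → E3} (hg : IsRationalCurve g) (hg' : IsRationalCurve g') :
    IsRational fun u => inner ℝ (g u) (g' u) := by
  simp only [inner_eq]
  exact (((hg 0).mul (hg' 0)).add ((hg 1).mul (hg' 1))).add ((hg 2).mul (hg' 2))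

theorem cross {g g' : ℝ → E3} (hg : IsRationalCurve g) (hg' : IsRationalCurve g') :
    IsRationalCurve fun u => cross (g u) (g' u) := by
  intro i
  fin_cases i
  · simpa using ((hg 1).mul (hg' 2)).sub ((hg 2).mul (hg' 1))
  · simpa using ((hg 2).mul (hg' 0)).sub ((hg 0).mul (hg' 2))
  · simpa using ((hg 0).mul (hg' 1)).sub ((hg 1).mul (hg' 0))

theorem deriv {g : ℝ → E3} (hg : IsRationalCurve g)
    (hd : ∀ᶠ u in cofinite, DifferentiableAt ℝ g u) : IsRationalCurve (deriv g) := by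
  intro i
  refine (hg i).deriv.congr ?_
  filter_upwards [hd] with u hu
  exact ((EuclideanSpace.proj (𝕜 := ℝ) i : E3 →L[ℝ] ℝ).hasFDerivAt.comp_hasDerivAt u
    hu.hasDerivAt).deriv.symm

/-- The triple of rational functions that represents the curve off a finite set. -/
theorem exists_curveAt {g : ℝ → E3} (hg : IsRationalCurve g) :
    ∃ m : Fin 3 → RatFunc ℝ, ∀ᶠ u in cofinite, RuledPedal.curveAt m u = g u := by
  choose m hm using hg
  refine ⟨m, ?_⟩
  filter_upwards [eventually_all.2 hm] with u hu
  ext i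
  exact (hu i).symm

end IsRationalCurve

/-! ### Regularity of rational curves -/

theorem analyticAt_ratFunc_eval {h : RatFunc ℝ} {u : ℝ} (hu : IsDefinedAt h u) :
    AnalyticAt ℝ (fun u => h.eval (RingHom.id ℝ) u) u := by
  simp only [ratFunc_eval_eq]
  have hp : ∀ p : ℝ[X], AnalyticAt ℝ (fun u => p.eval u) u := fun p => by
    simpa [coe_aeval_eq_eval] using (analyticAt_id (𝕜 := ℝ) (z := u)).aeval_polynomial p
  exact (hp _).div (hp _) hu

theorem analyticAt_curveAt {c : Fin 3 → RatFunc ℝ} {u : ℝ} (hu : ∀ i, IsDefinedAt (c i) u) :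
    AnalyticAt ℝ (curveAt c) u := by
  have h : curveAt c = fun u => ∑ i, (c i).eval (RingHom.id ℝ) u •
      (EuclideanSpace.single i (1 : ℝ) : E3) := by
    funext u
    ext j
    simp [curveAt, Finset.sum_apply, Pi.single_apply]
  rw [h]
  exact Finset.analyticAt_fun_sum _ fun i _ => (analyticAt_ratFunc_eval (hu i)).smul analyticAt_const

theorem eventually_mem_ruledBase (c e : Fin 3 → RatFunc ℝ) :
    ∀ᶠ u in cofinite, u ∈ ruledBase c e :=
  eventually_all.2 fun i => (eventually_isDefinedAt (c i)).and (eventually_isDefinedAt (e i))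

/-! ### Normal vectors and offsets of ruled surfaces -/

theorem differentiableAt_cross {E : Type*} [NormedAddCommGroup E] [NormedSpace ℝ E] {f g : E → E3}
    {x : E} (hf : DifferentiableAt ℝ f x) (hg : DifferentiableAt ℝ g x) :
    DifferentiableAt ℝ (fun y => cross (f y) (g y)) x := by
  rw [differentiableAt_piLp] at hf hg ⊢
  intro i
  fin_cases i
  · simpa using ((hf 1).fun_mul (hg 2)).fun_sub ((hf 2).fun_mul (hg 1))
  · simpa using ((hf 2).fun_mul (hg 0)).fun_sub ((hf 0).fun_mul (hg 2))
  · simpa using ((hf 0).fun_mul (hg 1)).fun_sub ((hf 1).fun_mul (hg 0))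

theorem continuous_cross : Continuous fun q : E3 × E3 => cross q.1 q.2 :=
  continuous_iff_continuousAt.2 fun _ =>
    (differentiableAt_cross differentiableAt_fst differentiableAt_snd).continuousAt

theorem differentiableAt_affine_family {g h : ℝ → E3} {p : ℝ × ℝ}
    (hg : DifferentiableAt ℝ g p.1) (hh : DifferentiableAt ℝ h p.1) :
    DifferentiableAt ℝ (fun q : ℝ × ℝ => g q.1 + q.2 • h q.1) p := by
  have hg' : DifferentiableAt ℝ (fun q : ℝ × ℝ => g q.1) p := hg.comp p differentiableAt_fst
  have hh' : DifferentiableAt ℝ (fun q : ℝ × ℝ => h q.1) p := hh.comp p differentiableAt_fst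
  exact hg'.add (differentiableAt_snd.smul hh')

theorem fderiv_affine_family {g h : ℝ → E3} {p : ℝ × ℝ}
    (hg : DifferentiableAt ℝ g p.1) (hh : DifferentiableAt ℝ h p.1) :
    fderiv ℝ (fun q : ℝ × ℝ => g q.1 + q.2 • h q.1) p (1, 0) = deriv g p.1 + p.2 • deriv h p.1 ∧
    fderiv ℝ (fun q : ℝ × ℝ => g q.1 + q.2 • h q.1) p (0, 1) = h p.1 := by
  have hg' : HasFDerivAt (fun q : ℝ × ℝ => g q.1) _ p :=
    hg.hasDerivAt.hasFDerivAt.comp p hasFDerivAt_fst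
  have hh' : HasFDerivAt (fun q : ℝ × ℝ => h q.1) _ p :=
    hh.hasDerivAt.hasFDerivAt.comp p hasFDerivAt_fst
  have := (hg'.add ((hasFDerivAt_snd (p := p)).smul hh')).fderiv
  have h2 : fderiv ℝ (fun q : ℝ × ℝ => g q.1 + q.2 • h q.1) p = _ := this
  rw [h2]
  constructor <;> simp

/-- The unit vector field of a nonvanishing vector field: differentiability, orthogonality of the
derivative, and a bound for the derivative. -/
theorem fderiv_normalize {N : ℝ × ℝ → E3} {p : ℝ × ℝ} (hN : DifferentiableAt ℝ N p)
    (h0 : N p ≠ 0) :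
    DifferentiableAt ℝ (fun q => ‖N q‖⁻¹ • N q) p ∧ ∀ w,
      inner ℝ (fderiv ℝ (fun q => ‖N q‖⁻¹ • N q) p w) (‖N p‖⁻¹ • N p) = 0 ∧
      ‖N p‖ * ‖fderiv ℝ (fun q => ‖N q‖⁻¹ • N q) p w‖ ≤ ‖fderiv ℝ N p w‖ := by
  set n : ℝ × ℝ → E3 := fun q => ‖N q‖⁻¹ • N q with hn
  have hρ : DifferentiableAt ℝ (fun q => ‖N q‖) p := hN.norm ℝ h0
  have hnd : DifferentiableAt ℝ n p := (hρ.inv (norm_ne_zero_iff.2 h0)).smul hN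
  have hev : ∀ᶠ q in 𝓝 p, N q ≠ 0 := hN.continuousAt.eventually_ne h0
  have hperp : ∀ w, inner ℝ (fderiv ℝ n p w) (n p) = 0 := by
    intro w
    -- Orthogonality comes from differentiating ⟨n, n⟩ = 1.
    have h1 : (fun q => inner ℝ (n q) (n q)) =ᶠ[𝓝 p] fun _ => (1 : ℝ) := by
      filter_upwards [hev] with q hq
      rw [real_inner_self_eq_norm_sq, hn]
      simp [norm_smul, inv_mul_cancel₀ (norm_ne_zero_iff.2 hq)]
    have h2 := fderiv_inner_apply ℝ hnd hnd w
    rw [h1.fderiv_eq] at h2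
    simp only [fderiv_fun_const, Pi.zero_apply, zero_apply] at h2
    rw [real_inner_comm] at h2
    linarith
  refine ⟨hnd, fun w => ⟨hperp w, ?_⟩⟩
  have h1 : N =ᶠ[𝓝 p] fun q => ‖N q‖ • n q := by
    filter_upwards [hev] with q hq
    simp only [hn]
    rw [smul_inv_smul₀ (norm_ne_zero_iff.2 hq)]
  have h2 : fderiv ℝ N p w = ‖N p‖ • fderiv ℝ n p w + (fderiv ℝ (fun q => ‖N q‖) p w) • n p := by
    rw [h1.fderiv_eq, fderiv_fun_smul hρ hnd]
    simp
  -- By the product rule, dN splits into the orthogonal parts ‖N‖ dn and (d‖N‖) n, so Pythagoras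
  -- bounds the first.
  have h4 : (‖N p‖ * ‖fderiv ℝ n p w‖) ^ 2 ≤ ‖fderiv ℝ N p w‖ ^ 2 := by
    rw [h2, norm_add_sq_real, inner_smul_left, inner_smul_right, hperp w]
    simp only [norm_smul, norm_norm]
    nlinarith [sq_nonneg (‖fderiv ℝ (fun q => ‖N q‖) p w‖ * ‖n p‖)]
  exact le_of_sq_le_sq h4 (norm_nonneg _)

theorem differentiableAt_curveAt {c : Fin 3 → RatFunc ℝ} {u : ℝ} (hu : ∀ i, IsDefinedAt (c i) u) :
    DifferentiableAt ℝ (curveAt c) u := (analyticAt_curveAt hu).differentiableAt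

theorem differentiableAt_deriv_curveAt {c : Fin 3 → RatFunc ℝ} {u : ℝ}
    (hu : ∀ i, IsDefinedAt (c i) u) : DifferentiableAt ℝ (deriv (curveAt c)) u :=
  (analyticAt_curveAt hu).deriv.differentiableAt

theorem isOpen_ruledBase (c e : Fin 3 → RatFunc ℝ) : IsOpen (ruledBase c e) := by
  have := Set.Finite.isClosed (eventually_mem_ruledBase c e)
  simpa using this.isOpen_compl

/-- The vector `c' × e`. -/
noncomputable def crossC (c e : Fin 3 → RatFunc ℝ) (u : ℝ) : E3 :=
  cross (deriv (curveAt c) u) (curveAt e u)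

/-- The normal vector field `c' × e + v e' × e` of the ruled surface `c + v e`. -/
noncomputable def normalVec (c e : Fin 3 → RatFunc ℝ) (p : ℝ × ℝ) : E3 :=
  crossC c e p.1 + p.2 • crossC e e p.1

/-- The unit normal field of the ruled surface `c + v e`. -/
noncomputable def normalDir (c e : Fin 3 → RatFunc ℝ) (p : ℝ × ℝ) : E3 :=
  ‖normalVec c e p‖⁻¹ • normalVec c e p

section

variable {c e : Fin 3 → RatFunc ℝ}

theorem differentiableAt_crossC {u : ℝ} (hu : u ∈ ruledBase c e) :
    DifferentiableAt ℝ (crossC c e) u :=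
  differentiableAt_cross (differentiableAt_deriv_curveAt fun i => (hu i).1)
    (differentiableAt_curveAt fun i => (hu i).2)

theorem differentiableAt_crossC_self {u : ℝ} (hu : u ∈ ruledBase c e) :
    DifferentiableAt ℝ (crossC e e) u :=
  differentiableAt_crossC (c := e) (e := e) fun i => ⟨(hu i).2, (hu i).2⟩

theorem fderiv_ruled {p : ℝ × ℝ} (hp : p.1 ∈ ruledBase c e) :
    fderiv ℝ (ruled c e) p (1, 0) = deriv (curveAt c) p.1 + p.2 • deriv (curveAt e) p.1 ∧
    fderiv ℝ (ruled c e) p (0, 1) = curveAt e p.1 :=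
  fderiv_affine_family (differentiableAt_curveAt fun i => (hp i).1)
    (differentiableAt_curveAt fun i => (hp i).2)

theorem cross_fderiv_ruled {p : ℝ × ℝ} (hp : p.1 ∈ ruledBase c e) :
    cross (fderiv ℝ (ruled c e) p (1, 0)) (fderiv ℝ (ruled c e) p (0, 1)) = normalVec c e p := by
  rw [(fderiv_ruled hp).1, (fderiv_ruled hp).2, cross_add_left, cross_smul_left]; rfl

theorem isRegularAt_ruled_iff {p : ℝ × ℝ} (hp : p.1 ∈ ruledBase c e) :
    IsRegularAt (ruled c e) p ↔ normalVec c e p ≠ 0 := by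
  rw [IsRegularAt, linearIndependent_pair_iff_cross, cross_fderiv_ruled hp]

theorem differentiableAt_normalVec {p : ℝ × ℝ} (hp : p.1 ∈ ruledBase c e) :
    DifferentiableAt ℝ (normalVec c e) p :=
  differentiableAt_affine_family (differentiableAt_crossC hp) (differentiableAt_crossC_self hp)

theorem inner_normalVec (p : ℝ × ℝ) : inner ℝ (normalVec c e p) (curveAt e p.1) = 0 := by
  simp [normalVec, crossC, inner_add_left, inner_smul_left, inner_cross_right]

theorem inner_normalDir (p : ℝ × ℝ) : inner ℝ (normalDir c e p) (curveAt e p.1) = 0 := by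
  rw [normalDir, inner_smul_left, inner_normalVec, mul_zero]

theorem norm_normalDir {p : ℝ × ℝ} (h : normalVec c e p ≠ 0) : ‖normalDir c e p‖ = 1 := by
  rw [normalDir, norm_smul, norm_inv, norm_norm, inv_mul_cancel₀ (norm_ne_zero_iff.2 h)]

theorem unitNormal_ruled {p : ℝ × ℝ} (hp : p.1 ∈ ruledBase c e) :
    unitNormal (ruled c e) p = normalDir c e p := by
  rw [unitNormal, cross_fderiv_ruled hp]; rfl

theorem fderiv_offset_ruled (d : ℝ) {p : ℝ × ℝ} (hp : p.1 ∈ ruledBase c e)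
    (h0 : normalVec c e p ≠ 0) (w : ℝ × ℝ) :
    fderiv ℝ (offset (ruled c e) d) p w =
      fderiv ℝ (ruled c e) p w + d • fderiv ℝ (normalDir c e) p w := by
  have hev : offset (ruled c e) d =ᶠ[𝓝 p] fun q => ruled c e q + d • normalDir c e q := by
    have hopen : ∀ᶠ q : ℝ × ℝ in 𝓝 p, q.1 ∈ ruledBase c e :=
      continuousAt_fst.eventually ((isOpen_ruledBase c e).mem_nhds hp)
    filter_upwards [hopen] with q hq
    rw [offset, unitNormal_ruled hq]
  have h1 : DifferentiableAt ℝ (normalDir c e) p :=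
    (fderiv_normalize (differentiableAt_normalVec hp) h0).1
  have h2 : DifferentiableAt ℝ (ruled c e) p := differentiableAt_affine_family
    (differentiableAt_curveAt fun i => (hp i).1) (differentiableAt_curveAt fun i => (hp i).2)
  rw [hev.fderiv_eq, fderiv_fun_add h2 (h1.fun_const_smul d), fderiv_fun_const_smul h1]
  simp

/-- Offsetting keeps the normal: the added term d · dn is orthogonal to n because n has unit length.
-/
theorem inner_fderiv_offset (d : ℝ) {p : ℝ × ℝ} (hp : p.1 ∈ ruledBase c e)
    (h0 : normalVec c e p ≠ 0) :
    inner ℝ (fderiv ℝ (offset (ruled c e) d) p (1, 0)) (normalDir c e p) = 0 ∧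
    inner ℝ (fderiv ℝ (offset (ruled c e) d) p (0, 1)) (normalDir c e p) = 0 := by
  have h := (fderiv_normalize (differentiableAt_normalVec hp) h0).2
  have h1 : ∀ w, inner ℝ (fderiv ℝ (normalDir c e) p w) (normalDir c e p) = 0 := fun w => (h w).1
  constructor
  · rw [fderiv_offset_ruled d hp h0, inner_add_left, inner_smul_left, h1, normalDir,
      inner_smul_right, ← cross_fderiv_ruled hp, real_inner_comm, inner_cross_left]
    simp
  · rw [fderiv_offset_ruled d hp h0, inner_add_left, inner_smul_left, h1, normalDir,
      inner_smul_right, ← cross_fderiv_ruled hp, real_inner_comm, inner_cross_right]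
    simp

end

theorem isFootPoint_iff {O q n P : E3} (hn : ‖n‖ = 1) :
    IsFootPoint O (AffineSubspace.mk' q (Submodule.span ℝ {n})ᗮ) P ↔
      P = O + (inner ℝ (q - O) n : ℝ) • n := by
  have hnn : inner ℝ n n = (1 : ℝ) := by rw [real_inner_self_eq_norm_sq, hn]; norm_num
  simp only [IsFootPoint, AffineSubspace.mem_mk', vsub_eq_sub,
    Submodule.mem_orthogonal_singleton_iff_inner_left]
  constructor
  · rintro ⟨h1, h2⟩
    have h3 : inner ℝ (P - O) n = inner ℝ (q - O) n := by
      rw [← sub_eq_zero, ← inner_sub_left, ← h1]; congr 1; abel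
    set z := (P - O) - (inner ℝ (P - O) n : ℝ) • n with hz
    have hzn : inner ℝ z n = 0 := by
      rw [hz, inner_sub_left, inner_smul_left, hnn]; simp
    -- Here z is the part of P - O orthogonal to n, so P + z stays in the plane; the foot-point
    -- condition tested at it forces ⟨z, z⟩ = 0.
    have h4 := h2 (P + z) (by
      rw [show P + z - q = (P - q) + z by abel, inner_add_left, h1, hzn, add_zero])
    rw [add_sub_cancel_left] at h4
    have h5 : inner ℝ z z = (0 : ℝ) := by
      nth_rewrite 1 [hz]
      rw [inner_sub_left, inner_smul_left, h4, real_inner_comm z n, hzn]; simp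
    have h6 : z = 0 := inner_self_eq_zero.1 h5
    rw [← h3, ← sub_eq_iff_eq_add']
    exact sub_eq_zero.1 h6
  · rintro rfl
    have h1 : inner ℝ (O + (inner ℝ (q - O) n : ℝ) • n - q) n = 0 := by
      rw [show O + (inner ℝ (q - O) n : ℝ) • n - q = (inner ℝ (q - O) n : ℝ) • n - (q - O) by abel,
        inner_sub_left, inner_smul_left, hnn]; simp
    refine ⟨h1, fun x hx => ?_⟩
    rw [add_sub_cancel_left, inner_smul_left, real_inner_comm (x - _) n,
      ← sub_sub_sub_cancel_right x _ q, inner_sub_left (x - q), hx, h1]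
    simp

section

variable {c e : Fin 3 → RatFunc ℝ}

/-- The term v e drops out of the support function since e is orthogonal to n, so v enters only
through the normal. -/
theorem isFootPoint_offset_iff {O P : E3} {d : ℝ} {p : ℝ × ℝ} (hp : p ∈ ruledDomain c e)
    (hreg : IsRegularAt (offset (ruled c e) d) p) :
    IsFootPoint O (tangentPlane (offset (ruled c e) d) p) P ↔
      P = footAt O (curveAt c p.1) d (normalDir c e p) := by
  have h0 := (isRegularAt_ruled_iff hp.1).1 hp.2
  have hn := norm_normalDir h0
  have hn0 : normalDir c e p ≠ 0 := by rw [← norm_ne_zero_iff, hn]; exact one_ne_zero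
  rw [tangentPlane, span_pair_eq_orthogonal hreg hn0 (inner_fderiv_offset d hp.1 h0).1
    (inner_fderiv_offset d hp.1 h0).2, isFootPoint_iff hn]
  have h1 : inner ℝ (offset (ruled c e) d p - O) (normalDir c e p) =
      inner ℝ (curveAt c p.1 - O) (normalDir c e p) + d := by
    rw [offset, unitNormal_ruled hp.1, ruled,
      show curveAt c p.1 + p.2 • curveAt e p.1 + d • normalDir c e p - O =
        (curveAt c p.1 - O) + p.2 • curveAt e p.1 + d • normalDir c e p by abel,
      inner_add_left, inner_add_left, inner_smul_left, inner_smul_left,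
      real_inner_comm _ (curveAt e p.1), inner_normalDir, real_inner_self_eq_norm_sq, hn]
    simp
  rw [h1]; rfl

theorem mem_pedalSet_offset_iff {O P : E3} {d : ℝ} {D : Set (ℝ × ℝ)} (hD : D ⊆ ruledDomain c e) :
    P ∈ pedalSet O (offset (ruled c e) d) D ↔
      ∃ p ∈ D, IsRegularAt (offset (ruled c e) d) p ∧
        P = footAt O (curveAt c p.1) d (normalDir c e p) := by
  constructor
  · rintro ⟨p, hp, hreg, h⟩
    exact ⟨p, hp, hreg, (isFootPoint_offset_iff (hD hp) hreg).1 h⟩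
  · rintro ⟨p, hp, hreg, h⟩
    exact ⟨p, hp, hreg, (isFootPoint_offset_iff (hD hp) hreg).2 h⟩

theorem offset_zero (f : ℝ × ℝ → E3) : offset f 0 = f := by
  funext p; simp [offset]

theorem tendsto_inv_smul_add (a b : E3) :
    Tendsto (fun v : ℝ => v⁻¹ • a + b) atTop (𝓝 b) := by
  simpa using ((tendsto_inv_atTop_zero (𝕜 := ℝ)).smul_const a).add_const b

/-- On a ruling with `e' × e ≠ 0`, the points of the offset are regular for all large `v`. -/
theorem eventually_isRegularAt_offset (d : ℝ) {u : ℝ} (hu : u ∈ ruledBase c e)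
    (hB : crossC e e u ≠ 0) (hN : ∀ v, normalVec c e (u, v) ≠ 0) :
    ∀ᶠ v in atTop, IsRegularAt (offset (ruled c e) d) (u, v) := by
  have hfac : ∀ v : ℝ, 0 < v → ∀ a b : E3, ‖a + v • b‖ = v * ‖v⁻¹ • a + b‖ := by
    intro v hv a b
    rw [← abs_of_pos hv, ← Real.norm_eq_abs, ← norm_smul, Real.norm_eq_abs, abs_of_pos hv,
      smul_add, smul_inv_smul₀ hv.ne']
  have hbound := fun v => (fderiv_normalize (differentiableAt_normalVec (p := (u, v)) hu) (hN v)).2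
  have hNd := fun v => fderiv_affine_family (p := (u, v)) (differentiableAt_crossC hu)
    (differentiableAt_crossC_self hu)
  -- The normal vector grows linearly in v. Its v-derivative is constant, so n_v is O(1/v); its
  -- u-derivative grows at most linearly, so n_u stays bounded.
  have hv0 : Tendsto (fun v => fderiv ℝ (normalDir c e) (u, v) (0, 1)) atTop (𝓝 0) := by
    have hlim : Tendsto (fun v : ℝ => v⁻¹ * (‖crossC e e u‖ / ‖v⁻¹ • crossC c e u + crossC e e u‖))
        atTop (𝓝 0) := by
      simpa using tendsto_inv_atTop_zero.mul ((tendsto_const_nhds (x := ‖crossC e e u‖)).div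
        (tendsto_inv_smul_add (crossC c e u) (crossC e e u)).norm (norm_ne_zero_iff.2 hB))
    refine squeeze_zero_norm' ?_ hlim
    filter_upwards [eventually_gt_atTop 0] with v hv
    have h1 := ((hbound v) (0, 1)).2
    have h2 : fderiv ℝ (normalVec c e) (u, v) (0, 1) = crossC e e u := (hNd v).2
    have h3 : ‖normalVec c e (u, v)‖ = v * ‖v⁻¹ • crossC c e u + crossC e e u‖ := hfac v hv _ _
    have h4 := norm_pos_iff.2 (hN v)
    rw [← div_eq_inv_mul, div_div, mul_comm _ v, ← h3, le_div_iff₀ h4, mul_comm, ← h2]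
    exact h1
  have hu0 : Tendsto (fun v : ℝ => v⁻¹ • fderiv ℝ (normalDir c e) (u, v) (1, 0)) atTop (𝓝 0) := by
    have hlim : Tendsto (fun v : ℝ => v⁻¹ * (‖v⁻¹ • deriv (crossC c e) u + deriv (crossC e e) u‖ /
        ‖v⁻¹ • crossC c e u + crossC e e u‖)) atTop (𝓝 0) := by
      simpa using tendsto_inv_atTop_zero.mul ((tendsto_inv_smul_add (deriv (crossC c e) u)
        (deriv (crossC e e) u)).norm.div (tendsto_inv_smul_add (crossC c e u) (crossC e e u)).norm
          (norm_ne_zero_iff.2 hB))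
    refine squeeze_zero_norm' ?_ hlim
    filter_upwards [eventually_gt_atTop 0] with v hv
    have h1 := ((hbound v) (1, 0)).2
    have h2 : fderiv ℝ (normalVec c e) (u, v) (1, 0) =
      deriv (crossC c e) u + v • deriv (crossC e e) u := (hNd v).1
    have h2' := congrArg norm h2
    rw [hfac v hv] at h2'
    have h3 : ‖normalVec c e (u, v)‖ = v * ‖v⁻¹ • crossC c e u + crossC e e u‖ := hfac v hv _ _
    have h4 := norm_pos_iff.2 (hN v)
    rw [norm_smul, norm_inv, Real.norm_of_nonneg hv.le]
    refine mul_le_mul_of_nonneg_left ?_ (inv_nonneg.2 hv.le)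
    rw [← mul_div_mul_left _ _ hv.ne', ← h3, ← h2', le_div_iff₀ h4, mul_comm]
    exact h1
  -- After division by v, the u-derivative of the offset tends to e', while the v-derivative tends
  -- to e. Their vector product tends to e' × e ≠ 0, which gives regularity for large v.
  have h1 : Tendsto (fun v : ℝ => v⁻¹ • fderiv ℝ (offset (ruled c e) d) (u, v) (1, 0)) atTop
      (𝓝 (deriv (curveAt e) u)) := by
    have := (tendsto_inv_smul_add (deriv (curveAt c) u) (deriv (curveAt e) u)).add
      (hu0.const_smul d)
    simp only [smul_zero, add_zero] at this
    refine this.congr' ?_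
    filter_upwards [eventually_gt_atTop 0] with v hv
    rw [fderiv_offset_ruled d hu (hN v), (fderiv_ruled (p := (u, v)) hu).1, smul_add, smul_add,
      inv_smul_smul₀ hv.ne', smul_comm d]
  have h2 : Tendsto (fun v : ℝ => fderiv ℝ (offset (ruled c e) d) (u, v) (0, 1)) atTop
      (𝓝 (curveAt e u)) := by
    have := (tendsto_const_nhds (x := curveAt e u)).add (hv0.const_smul d)
    simp only [smul_zero, add_zero] at this
    refine this.congr fun v => ?_
    rw [fderiv_offset_ruled d hu (hN v), (fderiv_ruled (p := (u, v)) hu).2]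
  have h3 := (continuous_cross.tendsto (deriv (curveAt e) u, curveAt e u)).comp
    (h1.prodMk_nhds h2)
  filter_upwards [h3.eventually_ne hB] with v hv
  rw [IsRegularAt, linearIndependent_pair_iff_cross]
  intro h
  apply hv
  simp only [Function.comp, cross_smul_left, h, smul_zero]

end

/-! ### Foot-point circles and their conchoids -/

/-- The component of `x` orthogonal to `e`. -/
noncomputable def perpPart (e x : E3) : E3 := x - (inner ℝ x e / inner ℝ e e : ℝ) • e

theorem inner_perpPart {e : E3} (he : e ≠ 0) (x : E3) : inner ℝ (perpPart e x) e = 0 := by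
  have : inner ℝ e e ≠ (0 : ℝ) := inner_self_ne_zero.2 he
  rw [perpPart, inner_sub_left, inner_smul_left]
  simp only [conj_trivial]
  field_simp
  ring

theorem inner_perpPart_of_orthogonal {e n : E3} (hn : inner ℝ n e = 0) (x : E3) :
    inner ℝ (perpPart e x) n = inner ℝ x n := by
  rw [perpPart, inner_sub_left, inner_smul_left, real_inner_comm n e, hn]; simp

theorem exists_unit_orthogonal {e w : E3} (he : e ≠ 0) (hw : inner ℝ w e = 0) :
    ∃ n : E3, ‖n‖ = 1 ∧ inner ℝ n e = 0 ∧ inner ℝ w n = 0 := by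
  by_cases hw0 : w = 0
  · obtain ⟨a, -, ha, -, -, hae, -⟩ := exists_orthonormal_frame he
    exact ⟨a, ha, hae, by rw [hw0, inner_zero_left]⟩
  have hx : cross w e ≠ 0 := by
    intro h
    have := norm_cross_sq w e
    rw [h, hw] at this
    simp [hw0, he] at this
  refine ⟨‖cross w e‖⁻¹ • cross w e, ?_, ?_, ?_⟩
  · rw [norm_smul, norm_inv, norm_norm, inv_mul_cancel₀ (norm_ne_zero_iff.2 hx)]
  · rw [inner_smul_left, inner_cross_right, mul_zero]
  · rw [inner_smul_right, real_inner_comm, inner_cross_left, mul_zero]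

/-- Thales: the foot-points form the circle over the segment from `O` to the projection of `c`. -/
theorem footCurve_zero_eq_circle {O c e : E3} (he : e ≠ 0) :
    footCurve O c e 0 =
      circle (O + (2⁻¹ : ℝ) • perpPart e (c - O)) (‖perpPart e (c - O)‖ ^ 2 / 4) e := by
  set w := perpPart e (c - O) with hw
  have hwe : inner ℝ w e = 0 := inner_perpPart he _
  ext x
  constructor
  · rintro ⟨n, hn, hne, rfl⟩
    have hwn : inner ℝ (c - O) n = inner ℝ w n := (inner_perpPart_of_orthogonal hne _).symm
    have h1 : footAt O c 0 n - (O + (2⁻¹ : ℝ) • w) =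
        (inner ℝ w n : ℝ) • n - (2⁻¹ : ℝ) • w := by
      rw [footAt, hwn, add_zero]; abel
    refine ⟨?_, ?_⟩
    · rw [h1, norm_sub_sq_real, norm_smul, norm_smul, inner_smul_left, inner_smul_right,
        real_inner_comm w n, hn, mul_pow, mul_pow, Real.norm_eq_abs, sq_abs]
      norm_num
      ring
    · rw [h1, inner_sub_left, inner_smul_left, inner_smul_left, hne, hwe]; simp
  · rintro ⟨h1, h2⟩
    set y := x - O with hy
    have hxy : x - (O + (2⁻¹ : ℝ) • w) = y - (2⁻¹ : ℝ) • w := by rw [hy]; abel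
    rw [hxy] at h1 h2
    have hye : inner ℝ y e = 0 := by
      rw [inner_sub_left, inner_smul_left, hwe] at h2; simpa using h2
    -- The circle equation in Thales form: y is orthogonal to y - w. Hence n = y/‖y‖ works unless y
    -- = 0, where any unit normal orthogonal to w and e is used.
    have hyw : ‖y‖ ^ 2 = inner ℝ w y := by
      rw [norm_sub_sq_real, norm_smul, inner_smul_right, mul_pow, real_inner_comm] at h1
      norm_num at h1
      linarith
    by_cases hy0 : y = 0
    · obtain ⟨n, hn, hne, hwn⟩ := exists_unit_orthogonal he hwe
      refine ⟨n, hn, hne, ?_⟩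
      rw [footAt, ← inner_perpPart_of_orthogonal hne, ← hw, hwn, ← sub_eq_zero, sub_add_eq_sub_sub,
        ← hy, hy0]
      simp
    · have hny := norm_ne_zero_iff.2 hy0
      have hne : inner ℝ (‖y‖⁻¹ • y) e = 0 := by rw [inner_smul_left, hye, mul_zero]
      refine ⟨‖y‖⁻¹ • y, ?_, hne, ?_⟩
      · rw [norm_smul, norm_inv, norm_norm, inv_mul_cancel₀ hny]
      · rw [footAt, ← inner_perpPart_of_orthogonal hne, ← hw, inner_smul_right, ← hyw, add_zero,
          smul_smul, show ‖y‖⁻¹ * ‖y‖ ^ 2 * ‖y‖⁻¹ = 1 by field_simp, one_smul, hy]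
        abel

/-- The points of the line `OP` at distance `|d|` from `P`. -/
theorem mem_line_and_dist_iff {O P Q : E3} (hP : P ≠ O) (d : ℝ) :
    (Q ∈ affineSpan ℝ {O, P} ∧ dist Q P = |d|) ↔
      ∃ l : ℝ, l ^ 2 = ‖P - O‖ ^ 2 ∧ Q = P + (d / l) • (P - O) := by
  have hn : ‖P - O‖ ≠ 0 := norm_ne_zero_iff.2 (sub_ne_zero.2 hP)
  constructor
  · rintro ⟨h1, h2⟩
    obtain ⟨k, rfl⟩ := mem_affineSpan_pair_iff_exists_lineMap_eq.1 h1
    have h3 : AffineMap.lineMap O P k - P = (k - 1) • (P - O) := by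
      rw [AffineMap.lineMap_apply_module', sub_smul, one_smul]; abel
    rw [dist_eq_norm, h3, norm_smul, Real.norm_eq_abs, ← abs_of_nonneg (norm_nonneg (P - O)),
      ← abs_mul, abs_eq_abs] at h2
    -- The sign of l selects one of the two points on the line at the given distance.
    rcases h2 with h2 | h2
    · refine ⟨‖P - O‖, rfl, ?_⟩
      rw [← h2, mul_div_cancel_right₀ _ hn, ← h3]; abel
    · refine ⟨-‖P - O‖, by ring, ?_⟩
      rw [← neg_eq_iff_eq_neg] at h2
      rw [← h2, neg_div_neg_eq, mul_div_cancel_right₀ _ hn, ← h3]; abel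
  · rintro ⟨l, hl, rfl⟩
    have hl0 : l ≠ 0 := by rintro rfl; apply hn; simpa using hl.symm
    refine ⟨mem_affineSpan_pair_iff_exists_lineMap_eq.2 ⟨1 + d / l, ?_⟩, ?_⟩
    · rw [AffineMap.lineMap_apply_module', add_smul, one_smul]; abel
    · rw [dist_eq_norm, add_sub_cancel_left, norm_smul, ← abs_of_nonneg (norm_nonneg (P - O)),
        ← (sq_eq_sq_iff_abs_eq_abs _ _).1 hl, Real.norm_eq_abs, ← abs_mul, div_mul_cancel₀ _ hl0]

theorem conchoid_mono {O : E3} {d : ℝ} {S S' : Set E3} (h : S ⊆ S') :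
    conchoid O d S ⊆ conchoid O d S' :=
  zariskiClosure_mono fun _ ⟨P, hP, hQ⟩ => ⟨P, h hP, hQ⟩

/-- The foot-point for d = 0 has signed distance l = ⟨c - O, n⟩ from O along n, so moving it by (d /
l)(P - O) = d n reaches the offset foot-point. A zero distance is excluded because P = O determines
no line. -/
theorem footAt_mem_conchoid {O c e n : E3} (d : ℝ) (hn : ‖n‖ = 1) (hne : inner ℝ n e = 0)
    (h0 : inner ℝ (c - O) n ≠ 0) : footAt O c d n ∈ conchoid O d (footCurve O c e 0) := by
  have hP : footAt O c 0 n - O = (inner ℝ (c - O) n : ℝ) • n := by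
    rw [footAt, add_zero, add_sub_cancel_left]
  have hn0 : n ≠ 0 := by rw [← norm_ne_zero_iff, hn]; exact one_ne_zero
  have hPO : footAt O c 0 n ≠ O := by
    rw [← sub_ne_zero, hP]; exact smul_ne_zero h0 hn0
  refine subset_zariskiClosure _ ⟨footAt O c 0 n, ⟨n, hn, hne, rfl⟩, hPO, ?_⟩
  refine (mem_line_and_dist_iff hPO d).2 ⟨inner ℝ (c - O) n, ?_, ?_⟩
  · rw [hP, norm_smul, hn, mul_one, Real.norm_eq_abs, sq_abs]
  · rw [hP, smul_smul, div_mul_cancel₀ _ h0, footAt, footAt]; module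

/-- The two conchoid points over the foot-point of n belong to n and to -n. -/
theorem conchoid_footCurve_subset (O c e : E3) (d : ℝ) :
    conchoid O d (footCurve O c e 0) ⊆ zariskiClosure (footCurve O c e d) := by
  refine zariskiClosure_mono ?_
  rintro Q ⟨P, ⟨n, hn, hne, rfl⟩, hPO, hQ⟩
  obtain ⟨l, hl, rfl⟩ := (mem_line_and_dist_iff hPO d).1 hQ
  have hP : footAt O c 0 n - O = (inner ℝ (c - O) n : ℝ) • n := by
    rw [footAt, add_zero, add_sub_cancel_left]
  have h0 : inner ℝ (c - O) n ≠ (0 : ℝ) := by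
    intro h; apply hPO; rw [← sub_eq_zero, hP, h, zero_smul]
  rw [hP, norm_smul, hn, mul_one, Real.norm_eq_abs, sq_abs, sq_eq_sq_iff_eq_or_eq_neg] at hl
  rcases hl with rfl | rfl
  · refine ⟨n, hn, hne, ?_⟩
    rw [hP, smul_smul, div_mul_cancel₀ _ h0, footAt, footAt]; module
  · refine ⟨-n, by rwa [norm_neg], by rw [inner_neg_left, hne, neg_zero], ?_⟩
    rw [footAt_neg, hP, smul_smul, div_neg, neg_mul, div_mul_cancel₀ _ h0, footAt, footAt]
    module

/-! ### The pencil of normals along a ruling -/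

/-- The direction of `a + v b`. -/
noncomputable def pencilDir (a b : E3) (v : ℝ) : E3 := ‖a + v • b‖⁻¹ • (a + v • b)

section

variable {a b : E3}

theorem add_smul_ne_zero (hab : LinearIndependent ℝ ![a, b]) (v : ℝ) : a + v • b ≠ 0 := by
  intro h
  have := LinearIndependent.pair_iff.1 hab 1 v (by rwa [one_smul])
  exact one_ne_zero this.1

theorem norm_pencilDir (hab : LinearIndependent ℝ ![a, b]) (v : ℝ) : ‖pencilDir a b v‖ = 1 := by
  rw [pencilDir, norm_smul, norm_inv, norm_norm,
    inv_mul_cancel₀ (norm_ne_zero_iff.2 (add_smul_ne_zero hab v))]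

theorem pencilDir_injective (hab : LinearIndependent ℝ ![a, b]) :
    Function.Injective (pencilDir a b) := by
  intro v v' h
  simp only [pencilDir] at h
  set k := ‖a + v • b‖⁻¹ with hk
  set k' := ‖a + v' • b‖⁻¹
  have hk0 : k ≠ 0 := inv_ne_zero (norm_ne_zero_iff.2 (add_smul_ne_zero hab v))
  have h1 : (k - k') • a + (k * v - k' * v') • b = 0 := by
    have : k • (a + v • b) - k' • (a + v' • b) = 0 := sub_eq_zero.2 h
    rw [← this]; module
  obtain ⟨h2, h3⟩ := LinearIndependent.pair_iff.1 hab _ _ h1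
  rw [← sub_eq_zero.1 h2, ← mul_sub] at h3
  exact sub_eq_zero.1 ((mul_eq_zero.1 h3).resolve_left hk0)

theorem tendsto_pencilDir (hb : b ≠ 0) :
    Tendsto (pencilDir a b) atTop (𝓝 (‖b‖⁻¹ • b)) := by
  have h1 := tendsto_inv_smul_add a b
  have h2 := (h1.norm.inv₀ (norm_ne_zero_iff.2 hb)).smul h1
  refine h2.congr' ?_
  filter_upwards [eventually_gt_atTop 0] with v hv
  have h3 : a + v • b = v • (v⁻¹ • a + b) := by rw [smul_add, smul_inv_smul₀ hv.ne']
  rw [pencilDir, h3, norm_smul, Real.norm_of_nonneg hv.le, smul_smul, mul_inv]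
  congr 1
  field_simp

theorem inner_pencilDir {e : E3} (ha : inner ℝ a e = 0) (hb : inner ℝ b e = 0) (v : ℝ) :
    inner ℝ (pencilDir a b v) e = 0 := by
  rw [pencilDir, inner_smul_left, inner_add_left, inner_smul_left, ha, hb]; simp

/-- Up to a positive factor the inner product is affine in v. Two zeros would make the projection of
x orthogonal to a and b, hence zero; so at most one v is excluded. -/
theorem infinite_inner_pencilDir_ne_zero {e x : E3} (hab : LinearIndependent ℝ ![a, b])
    (he : e ≠ 0) (ha : inner ℝ a e = 0) (hb : inner ℝ b e = 0) (hx : perpPart e x ≠ 0) :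
    {v | inner ℝ x (pencilDir a b v) ≠ 0}.Infinite := by
  set w := perpPart e x with hw
  have hwv : ∀ v, inner ℝ x (pencilDir a b v) = ‖a + v • b‖⁻¹ * (inner ℝ w a + v * inner ℝ w b) := by
    intro v
    rw [← inner_perpPart_of_orthogonal (inner_pencilDir ha hb v), ← hw, pencilDir, inner_smul_right,
      inner_add_right, inner_smul_right]
  have hsub : {v | inner ℝ x (pencilDir a b v) ≠ 0}ᶜ.Subsingleton := by
    intro v hv v' hv'
    simp only [Set.mem_compl_iff, Set.mem_ofPred_eq, not_not, hwv, mul_eq_zero, inv_eq_zero,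
      norm_eq_zero, add_smul_ne_zero hab, false_or] at hv hv'
    by_contra hne
    have hb0 : inner ℝ w b = 0 := by
      have : (v - v') * inner ℝ w b = 0 := by linarith
      exact (mul_eq_zero.1 this).resolve_left (sub_ne_zero.2 hne)
    have ha0 : inner ℝ w a = 0 := by rw [hb0] at hv; linarith
    obtain ⟨α, β, hαβ⟩ := exists_combination_of_inner_eq_zero hab he ha hb (inner_perpPart he x)
    apply hx
    rw [← inner_self_eq_zero (𝕜 := ℝ)]
    nth_rewrite 2 [hw]
    rw [← hαβ, inner_add_right, inner_smul_right, inner_smul_right, ha0, hb0]; simp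
  exact fun h => Set.infinite_univ (by simpa using h.union hsub.finite)

/-- Up to sign, the pencil reaches every unit vector of the plane except the direction of b, which
is its limit as v → ∞. The sign is harmless only because d = 0. -/
theorem footCurve_zero_subset_closure {O c e : E3} (hab : LinearIndependent ℝ ![a, b])
    (he : e ≠ 0) (ha : inner ℝ a e = 0) (hb : inner ℝ b e = 0) :
    footCurve O c e 0 ⊆ closure (Set.range fun v => footAt O c 0 (pencilDir a b v)) := by
  have hb0 : b ≠ 0 := by
    intro h
    have := LinearIndependent.pair_iff.1 hab 0 1 (by simp [h])
    exact one_ne_zero this.2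
  have hsign : ∀ x : E3, footAt O c 0 (-x) = footAt O c 0 x := fun x => by
    rw [footAt_neg, neg_zero]
  have key : ∀ (k : ℝ) (y : E3), ‖k • y‖ = 1 →
      footAt O c 0 (k • y) = footAt O c 0 (‖y‖⁻¹ • y) := by
    intro k y h
    rw [norm_smul, Real.norm_eq_abs] at h
    have h1 : |k| = ‖y‖⁻¹ := eq_inv_of_mul_eq_one_left h
    rcases abs_choice k with hk | hk
    · rw [← h1, hk]
    · rw [← h1, hk, neg_smul, hsign]
  rintro x ⟨n, hn, hne, rfl⟩
  obtain ⟨α, β, rfl⟩ := exists_combination_of_inner_eq_zero hab he ha hb hne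
  by_cases hα : α = 0
  · subst hα
    rw [zero_smul, zero_add] at hn ⊢
    rw [key β b hn]
    exact mem_closure_of_tendsto (((continuous_footAt O c 0).tendsto _).comp
      (tendsto_pencilDir hb0)) (Eventually.of_forall fun v => ⟨v, rfl⟩)
  · have h1 : α • a + β • b = α • (a + (β / α) • b) := by
      rw [smul_add, smul_smul, mul_div_cancel₀ _ hα]
    rw [h1] at hn ⊢
    rw [key _ _ hn]
    exact subset_closure ⟨β / α, rfl⟩

end

theorem isClosed_circle (m : E3) (q : ℝ) (e : E3) : IsClosed (circle m q e) :=
  (isClosed_eq (by fun_prop) continuous_const).inter (isClosed_eq (by fun_prop) continuous_const)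

/-- The parameters of the rulings for which the foot-points form a proper circle. -/
structure IsGood (c e : Fin 3 → RatFunc ℝ) (O : E3) (u : ℝ) : Prop where
  mem_base : u ∈ ruledBase c e
  indep : LinearIndependent ℝ ![crossC c e u, crossC e e u]
  perp_ne_zero : perpPart (curveAt e u) (curveAt c u - O) ≠ 0

/-- The curve of foot-points of the tangent planes of the offset along a ruling. -/
def rulingCurve (c e : Fin 3 → RatFunc ℝ) (O : E3) (d u : ℝ) : Set E3 :=
  footCurve O (curveAt c u) (curveAt e u) d

section

variable {c e : Fin 3 → RatFunc ℝ} {O : E3} {u : ℝ}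

theorem inner_crossC (c e : Fin 3 → RatFunc ℝ) (u : ℝ) :
    inner ℝ (crossC c e u) (curveAt e u) = 0 := inner_cross_right _ _

theorem IsGood.crossC_self_ne_zero (h : IsGood c e O u) : crossC e e u ≠ 0 := by
  intro h0
  have := LinearIndependent.pair_iff.1 h.indep 0 1 (by simp [h0])
  exact one_ne_zero this.2

theorem IsGood.direction_ne_zero (h : IsGood c e O u) : curveAt e u ≠ 0 := by
  intro h0
  apply h.crossC_self_ne_zero
  rw [crossC, h0]; simp [cross]

theorem IsGood.mem_rulingDomain (h : IsGood c e O u) (v : ℝ) : (u, v) ∈ rulingDomain c e u :=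
  ⟨⟨h.mem_base, (isRegularAt_ruled_iff (p := (u, v)) h.mem_base).2 (add_smul_ne_zero h.indep v)⟩,
    rfl⟩

theorem rulingDomain_subset (c e : Fin 3 → RatFunc ℝ) (u : ℝ) :
    rulingDomain c e u ⊆ ruledDomain c e := fun _ h => h.1

theorem pedalSet_ruling_subset (c e : Fin 3 → RatFunc ℝ) (O : E3) (d u : ℝ) :
    pedalSet O (offset (ruled c e) d) (rulingDomain c e u) ⊆ rulingCurve c e O d u := by
  intro P hP
  obtain ⟨p, ⟨hp, rfl⟩, -, rfl⟩ := (mem_pedalSet_offset_iff (rulingDomain_subset c e u)).1 hP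
  exact ⟨normalDir c e p, norm_normalDir ((isRegularAt_ruled_iff hp.1).1 hp.2), inner_normalDir p,
    rfl⟩

/-- The points with large v are regular on the offset and have infinitely many distinct normals,
which is enough for the Zariski closure. -/
theorem IsGood.rulingCurve_subset (h : IsGood c e O u) (d : ℝ) :
    rulingCurve c e O d u ⊆
      zariskiClosure (pedalSet O (offset (ruled c e) d) (rulingDomain c e u)) := by
  obtain ⟨v₀, hv₀⟩ := eventually_atTop.1 (eventually_isRegularAt_offset d h.mem_base
    h.crossC_self_ne_zero fun v => add_smul_ne_zero h.indep v)
  refine footCurve_subset_zariskiClosure h.direction_ne_zero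
    (Z := pencilDir (crossC c e u) (crossC e e u) '' Set.Ici v₀)
    ((Set.Ici_infinite v₀).image (pencilDir_injective h.indep).injOn) ?_ ?_
  · rintro _ ⟨v, -, rfl⟩
    exact ⟨norm_pencilDir h.indep v, inner_pencilDir (inner_crossC _ _ _) (inner_crossC _ _ _) v⟩
  · rintro _ ⟨v, hv, rfl⟩
    exact subset_zariskiClosure _ ((mem_pedalSet_offset_iff (rulingDomain_subset c e u)).2
      ⟨(u, v), h.mem_rulingDomain v, hv₀ v hv, rfl⟩)

theorem IsGood.zariskiClosure_pedalSet (h : IsGood c e O u) (d : ℝ) :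
    zariskiClosure (pedalSet O (offset (ruled c e) d) (rulingDomain c e u)) =
      zariskiClosure (rulingCurve c e O d u) :=
  (zariskiClosure_mono (pedalSet_ruling_subset c e O d u)).antisymm
    (zariskiClosure_subset_iff.2 (h.rulingCurve_subset d))

theorem IsGood.rulingCurve_subset_conchoid (h : IsGood c e O u) (d : ℝ) :
    rulingCurve c e O d u ⊆ conchoid O d (rulingCurve c e O 0 u) := by
  refine footCurve_subset_zariskiClosure h.direction_ne_zero
    (Z := pencilDir (crossC c e u) (crossC e e u) ''
      {v | inner ℝ (curveAt c u - O) (pencilDir (crossC c e u) (crossC e e u) v) ≠ 0})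
    ((infinite_inner_pencilDir_ne_zero h.indep h.direction_ne_zero (inner_crossC _ _ _)
      (inner_crossC _ _ _) h.perp_ne_zero).image (pencilDir_injective h.indep).injOn) ?_ ?_
  · rintro _ ⟨v, -, rfl⟩
    exact ⟨norm_pencilDir h.indep v, inner_pencilDir (inner_crossC _ _ _) (inner_crossC _ _ _) v⟩
  · rintro _ ⟨v, hv, rfl⟩
    exact footAt_mem_conchoid d (norm_pencilDir h.indep v)
      (inner_pencilDir (inner_crossC _ _ _) (inner_crossC _ _ _) v) hv

theorem IsGood.conchoid_rulingCurve (h : IsGood c e O u) (d : ℝ) :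
    conchoid O d (rulingCurve c e O 0 u) = zariskiClosure (rulingCurve c e O d u) :=
  (conchoid_footCurve_subset _ _ _ _).antisymm
    (zariskiClosure_subset_iff.2 (h.rulingCurve_subset_conchoid d))

theorem IsGood.rulingCurve_zero (h : IsGood c e O u) :
    rulingCurve c e O 0 u =
      circle (O + (2⁻¹ : ℝ) • perpPart (curveAt e u) (curveAt c u - O))
        (‖perpPart (curveAt e u) (curveAt c u - O)‖ ^ 2 / 4) (curveAt e u) :=
  footCurve_zero_eq_circle h.direction_ne_zero

theorem IsGood.closure_pedalSet (h : IsGood c e O u) :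
    closure (pedalSet O (ruled c e) (rulingDomain c e u)) = rulingCurve c e O 0 u := by
  apply subset_antisymm
  · refine closure_minimal ?_ (h.rulingCurve_zero ▸ isClosed_circle _ _ _)
    have := pedalSet_ruling_subset c e O 0 u
    rwa [offset_zero] at this
  · refine (footCurve_zero_subset_closure h.indep h.direction_ne_zero (inner_crossC _ _ _)
      (inner_crossC _ _ _)).trans (closure_mono ?_)
    rintro _ ⟨v, rfl⟩
    have := (mem_pedalSet_offset_iff (O := O) (d := 0) (rulingDomain_subset c e u)).2
      ⟨(u, v), h.mem_rulingDomain v, by rw [offset_zero]; exact (h.mem_rulingDomain v).1.2, rfl⟩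
    rwa [offset_zero] at this

end

/-! ### Almost all rulings are good -/

section

variable {c e : Fin 3 → RatFunc ℝ}

theorem isRationalCurve_crossC (c e : Fin 3 → RatFunc ℝ) : IsRationalCurve (crossC c e) := by
  refine ((IsRationalCurve.curveAt c).deriv ?_).cross (IsRationalCurve.curveAt e)
  filter_upwards [eventually_mem_ruledBase c e] with u hu
  exact differentiableAt_curveAt fun i => (hu i).1

theorem isRationalCurve_perpPart (c e : Fin 3 → RatFunc ℝ) (O : E3) :
    IsRationalCurve fun u => perpPart (curveAt e u) (curveAt c u - O) := by
  have h := (IsRationalCurve.curveAt c).sub (IsRationalCurve.const O)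
  exact h.sub (IsRationalCurve.smul ((h.inner (IsRationalCurve.curveAt e)).div
    ((IsRationalCurve.curveAt e).inner (IsRationalCurve.curveAt e)))
      (IsRationalCurve.curveAt e))

/-- The squared length of (c' × e) × (e' × e) is rational, and nonzero and continuous at one
parameter. -/
theorem eventually_linearIndependent (hF : ¬ IsDevelopable c e) :
    ∀ᶠ u in cofinite, LinearIndependent ℝ ![crossC c e u, crossC e e u] := by
  simp only [IsDevelopable, not_forall, not_not] at hF
  obtain ⟨u₀, hu₀, h⟩ := hF
  have h' : cross (crossC c e u₀) (crossC e e u₀) ≠ 0 := linearIndependent_pair_iff_cross.1 h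
  have hr := (isRationalCurve_crossC c e).cross (isRationalCurve_crossC e e)
  have hc : ContinuousAt (fun u => cross (crossC c e u) (crossC e e u)) u₀ :=
    (differentiableAt_cross (differentiableAt_crossC hu₀)
      (differentiableAt_crossC_self hu₀)).continuousAt
  have hne := (hr.inner hr).eventually_ne_zero (hc.inner hc) (inner_self_ne_zero.2 h')
  filter_upwards [hne] with u hu
  exact linearIndependent_pair_iff_cross.2 (inner_self_ne_zero.1 hu)

/-- A ruling through `O` on an open set of parameters would make the surface a cone. -/
theorem crossC_eq_smul_of_perpPart_eventually_eq_zero {O : E3} {u : ℝ} (hu : u ∈ ruledBase c e)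
    (he : curveAt e u ≠ 0)
    (h : ∀ᶠ x in 𝓝 u, perpPart (curveAt e x) (curveAt c x - O) = 0) :
    ∃ l : ℝ, crossC c e u = l • crossC e e u := by
  have hc := differentiableAt_curveAt fun i => (hu i).1
  have hd := differentiableAt_curveAt fun i => (hu i).2
  set l : ℝ → ℝ := fun x => inner ℝ (curveAt c x - O) (curveAt e x) /
    inner ℝ (curveAt e x) (curveAt e x) with hl
  have hld : DifferentiableAt ℝ l u :=
    ((hc.sub_const O).inner ℝ hd).div (hd.inner ℝ hd) (inner_self_ne_zero.2 he)
  -- If the rulings pass through O, then c = O + l e, so c' = l' e + l e' and c' × e = l (e' × e).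
  have hev : curveAt c =ᶠ[𝓝 u] fun x => O + l x • curveAt e x := by
    filter_upwards [h] with x hx
    have := sub_eq_zero.1 hx
    rw [← this]; abel
  have h1 : HasDerivAt (fun x => O + l x • curveAt e x) _ u :=
    (hld.hasDerivAt.smul hd.hasDerivAt).const_add O
  refine ⟨l u, ?_⟩
  rw [crossC, hev.deriv_eq, h1.deriv, cross_add_left, cross_smul_left, cross_smul_left, cross_self,
    smul_zero, add_zero]
  rfl

theorem eventually_isGood (hF : ¬ IsDevelopable c e) (O : E3) :
    ∀ᶠ u in cofinite, IsGood c e O u := by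
  have hli := eventually_linearIndependent hF
  have hr := isRationalCurve_perpPart c e O
  rcases (hr.inner hr).eventually_eq_zero_or_ne_zero with h | h
  · exfalso
    obtain ⟨u, h1, h2, h3⟩ := ((eventually_eventually_nhds h).and
      ((eventually_mem_ruledBase c e).and hli)).exists
    have he : curveAt e u ≠ 0 := by
      intro h0
      have := LinearIndependent.pair_iff.1 h3 0 1 (by rw [crossC, crossC, h0]; simp [cross])
      exact one_ne_zero this.2
    obtain ⟨l, hl⟩ := crossC_eq_smul_of_perpPart_eventually_eq_zero h2 he
      (h1.mono fun x hx => inner_self_eq_zero.1 hx)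
    have := LinearIndependent.pair_iff.1 h3 1 (-l) (by rw [hl]; module)
    exact one_ne_zero this.1
  · filter_upwards [h, hli, eventually_mem_ruledBase c e] with u h1 h2 h3
    exact ⟨h3, h2, inner_self_ne_zero.1 h1⟩

/-! ### The pedal surface as a union of foot-point curves -/

theorem continuousAt_normalVec {u v : ℝ} (hu : u ∈ ruledBase c e) :
    ContinuousAt (fun x => normalVec c e (x, v)) u :=
  ContinuousAt.comp (f := fun x : ℝ => (x, v))
    (differentiableAt_normalVec (p := (u, v)) hu).continuousAt (by fun_prop)

theorem continuousAt_footAt_normalDir (O : E3) (d : ℝ) {u v : ℝ} (hu : u ∈ ruledBase c e)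
    (h0 : normalVec c e (u, v) ≠ 0) :
    ContinuousAt (fun x => footAt O (curveAt c x) d (normalDir c e (x, v))) u := by
  have h1 := continuousAt_normalVec (v := v) hu
  have h2 : ContinuousAt (fun x => normalDir c e (x, v)) u :=
    (h1.norm.inv₀ (norm_ne_zero_iff.2 h0)).smul h1
  have h3 : ContinuousAt (fun x => curveAt c x - O) u :=
    (differentiableAt_curveAt fun i => (hu i).1).continuousAt.sub continuousAt_const
  have h4 : ContinuousAt
      (fun x => (inner ℝ (curveAt c x - O) (normalDir c e (x, v)) + d : ℝ)) u :=
    (h3.inner h2).add continuousAt_const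
  exact continuousAt_const.add (h4.smul h2)

/-- A foot-point on an exceptional ruling is the limit, with v fixed and u varying, of points on
foot-point curves of good rulings. Those nearby points need not come from regular points of the
offset, as the curves contain all unit normals. -/
theorem pedalSurface_offset_eq {O : E3} {T : Set ℝ} (hT : T.Finite)
    (hgood : ∀ u, u ∉ T → IsGood c e O u) (d : ℝ) :
    pedalSurface O (offset (ruled c e) d) (ruledDomain c e) =
      zariskiClosure (⋃ u ∈ Tᶜ, rulingCurve c e O d u) := by
  apply subset_antisymm
  · refine zariskiClosure_subset_iff.2 fun P hP => ?_
    obtain ⟨⟨u₀, v⟩, hp, -, rfl⟩ := (mem_pedalSet_offset_iff subset_rfl).1 hP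
    have h0 := (isRegularAt_ruled_iff hp.1).1 hp.2
    refine mem_zariskiClosure_of_eventually (u := u₀)
      (g := fun x => footAt O (curveAt c x) d (normalDir c e (x, v)))
      (continuousAt_footAt_normalDir O d hp.1 h0) ?_
    have h2 : ∀ᶠ u in 𝓝[≠] u₀, normalVec c e (u, v) ≠ 0 :=
      ((continuousAt_normalVec hp.1).eventually_ne h0).filter_mono nhdsWithin_le_nhds
    filter_upwards [h2, eventually_nhdsNE_of_cofinite (hT.eventually_cofinite_notMem) u₀]
      with u hu huT
    exact subset_zariskiClosure _ (Set.mem_biUnion (x := u) huT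
      ⟨normalDir c e (u, v), norm_normalDir hu, inner_normalDir (u, v), rfl⟩)
  · refine zariskiClosure_subset_iff.2 (Set.iUnion₂_subset fun u hu => ?_)
    refine ((hgood u hu).rulingCurve_subset d).trans (zariskiClosure_mono ?_)
    rintro P ⟨p, hp, h⟩
    exact ⟨p, hp.1, h⟩

end

/-! ### Conchoids of Zariski closures -/

/-- Along the conchoid transformation, a polynomial becomes, up to a power of the signed distance
`l`, of the form `a + l b` with polynomials `a` and `b`. -/
theorem exists_conchoid_pullback (O : E3) (d : ℝ) (p : MvPolynomial (Fin 3) ℝ) :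
    ∃ (k : ℕ) (a b : MvPolynomial (Fin 3) ℝ), ∀ (x : E3) (l : ℝ), l ≠ 0 → l ^ 2 = ‖x - O‖ ^ 2 →
      l ^ k * MvPolynomial.eval (fun i => (x + (d / l) • (x - O)) i) p =
        MvPolynomial.eval (fun i => x i) a + l * MvPolynomial.eval (fun i => x i) b := by
  set R : MvPolynomial (Fin 3) ℝ := (MvPolynomial.X 0 - MvPolynomial.C (O 0)) ^ 2 +
    (MvPolynomial.X 1 - MvPolynomial.C (O 1)) ^ 2 + (MvPolynomial.X 2 - MvPolynomial.C (O 2)) ^ 2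
    with hR
  have hRx : ∀ x : E3, MvPolynomial.eval (fun i => x i) R = ‖x - O‖ ^ 2 := by
    intro x; simp [hR, norm_sq_eq]
  -- Since l² = R(x), multiplication by l turns the pair (a, b) into (R b, a).
  have hpow : ∀ (j : ℕ) (a b : MvPolynomial (Fin 3) ℝ), ∃ a' b' : MvPolynomial (Fin 3) ℝ,
      ∀ (x : E3) (l : ℝ), l ^ 2 = ‖x - O‖ ^ 2 →
        l ^ j * (MvPolynomial.eval (fun i => x i) a + l * MvPolynomial.eval (fun i => x i) b) =
          MvPolynomial.eval (fun i => x i) a' + l * MvPolynomial.eval (fun i => x i) b' := by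
    intro j a b
    induction j with
    | zero => exact ⟨a, b, fun x l _ => by ring⟩
    | succ j ih =>
      obtain ⟨a', b', h⟩ := ih
      refine ⟨R * b', a', fun x l hl => ?_⟩
      rw [pow_succ', mul_assoc, h x l hl, map_mul, hRx, ← hl]; ring
  induction p using MvPolynomial.induction_on with
  | C r => exact ⟨0, MvPolynomial.C r, 0, fun x l _ _ => by simp⟩
  | add p q hp hq =>
    obtain ⟨k, a, b, h⟩ := hp
    obtain ⟨k', a', b', h'⟩ := hq
    obtain ⟨a₁, b₁, h₁⟩ := hpow k' a b
    obtain ⟨a₂, b₂, h₂⟩ := hpow k a' b'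
    refine ⟨k + k', a₁ + a₂, b₁ + b₂, fun x l hl0 hl => ?_⟩
    have e1 := h₁ x l hl
    have e2 := h₂ x l hl
    rw [← h x l hl0 hl] at e1
    rw [← h' x l hl0 hl] at e2
    simp only [map_add, pow_add]
    linear_combination e1 + e2
  | mul_X p i hp =>
    obtain ⟨k, a, b, h⟩ := hp
    -- One further factor l turns the new coordinate into l xᵢ + d (xᵢ - Oᵢ); the product with a + l
    -- b is reduced by l² = R.
    refine ⟨k + 1, MvPolynomial.C d * (MvPolynomial.X i - MvPolynomial.C (O i)) * a +
      R * (MvPolynomial.X i * b), MvPolynomial.X i * a +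
        MvPolynomial.C d * (MvPolynomial.X i - MvPolynomial.C (O i)) * b, fun x l hl0 hl => ?_⟩
    have e1 := h x l hl0 hl
    have e2 : l * (x + (d / l) • (x - O)) i = l * x i + d * (x i - O i) := by
      simp only [PiLp.add_apply, PiLp.smul_apply, PiLp.sub_apply, smul_eq_mul]
      field_simp
    simp only [map_mul, map_add, map_sub, MvPolynomial.eval_X, MvPolynomial.eval_C, hRx, ← hl]
    rw [pow_succ]
    calc _ = (l ^ k * MvPolynomial.eval (fun i => (x + (d / l) • (x - O)) i) p) *
          (l * (x + (d / l) • (x - O)) i) := by ring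
      _ = _ := by rw [e1, e2]; ring

/-- If the conchoid of every point of `S` belongs to a Zariski closed set, then so does the conchoid
of every point of the Zariski closure of `S`. -/
theorem conchoid_zariskiClosure_subset {O : E3} {d : ℝ} {S S' : Set E3}
    (h : conchoid O d S ⊆ zariskiClosure S') :
    conchoid O d (zariskiClosure S) ⊆ zariskiClosure S' := by
  refine zariskiClosure_subset_iff.2 ?_
  rintro Q ⟨P, hP, hPO, hQ⟩ p hp
  obtain ⟨l, hl, rfl⟩ := (mem_line_and_dist_iff hPO d).1 hQ
  have hnP : ‖P - O‖ ≠ 0 := norm_ne_zero_iff.2 (sub_ne_zero.2 hPO)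
  have hl0 : l ≠ 0 := by rintro rfl; apply hnP; simpa using hl.symm
  obtain ⟨k, a, b, hab⟩ := exists_conchoid_pullback O d p
  set R : MvPolynomial (Fin 3) ℝ := (MvPolynomial.X 0 - MvPolynomial.C (O 0)) ^ 2 +
    (MvPolynomial.X 1 - MvPolynomial.C (O 1)) ^ 2 + (MvPolynomial.X 2 - MvPolynomial.C (O 2)) ^ 2
    with hR
  have hRx : ∀ x : E3, MvPolynomial.eval (fun i => x i) R = ‖x - O‖ ^ 2 := by
    intro x; simp [hR, norm_sq_eq]
  have hS : ∀ y ∈ S, y ≠ O → MvPolynomial.eval (fun i => y i) a = 0 ∧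
      MvPolynomial.eval (fun i => y i) b = 0 := by
    intro y hy hyO
    have hny : ‖y - O‖ ≠ 0 := norm_ne_zero_iff.2 (sub_ne_zero.2 hyO)
    -- Both signs of l are available over a real point y, so a + l b = 0 = a - l b separates into a
    -- = b = 0.
    have key : ∀ l : ℝ, l ≠ 0 → l ^ 2 = ‖y - O‖ ^ 2 →
        MvPolynomial.eval (fun i => y i) a + l * MvPolynomial.eval (fun i => y i) b = 0 := by
      intro l hl0 hl
      have hmem : y + (d / l) • (y - O) ∈ zariskiClosure S' :=
        h (subset_zariskiClosure _ ⟨y, hy, hyO, (mem_line_and_dist_iff hyO d).2 ⟨l, hl, rfl⟩⟩)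
      rw [← hab y l hl0 hl, hmem p hp, mul_zero]
    have e1 := key _ hny rfl
    have e2 := key (-‖y - O‖) (neg_ne_zero.2 hny) (by ring)
    have e3 : MvPolynomial.eval (fun i => y i) a = 0 := by linarith
    refine ⟨e3, (mul_eq_zero.1 (?_ : ‖y - O‖ * _ = 0)).resolve_left hny⟩
    linarith
  have hext : ∀ g : MvPolynomial (Fin 3) ℝ,
      (∀ y ∈ S, y ≠ O → MvPolynomial.eval (fun i => y i) g = 0) →
        MvPolynomial.eval (fun i => P i) g = 0 := by
    intro g hg
    -- The factor R vanishes at O, the one point of S where g is not controlled, and is nonzero at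
    -- P.
    have := hP (R * g) fun y hy => by
      rw [map_mul, hRx]
      by_cases hyO : y = O
      · simp [hyO]
      · rw [hg y hy hyO, mul_zero]
    rw [map_mul, hRx] at this
    exact (mul_eq_zero.1 this).resolve_left (pow_ne_zero 2 hnP)
  have e1 := hab P l hl0 hl
  rw [hext a fun y hy hyO => (hS y hy hyO).1, hext b fun y hy hyO => (hS y hy hyO).2, mul_zero,
    add_zero] at e1
  exact (mul_eq_zero.1 e1).resolve_left (pow_ne_zero k hl0)

theorem conchoid_iUnion_subset {ι : Type*} {O : E3} {d : ℝ} {s : Set ι} {S : ι → Set E3}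
    {S' : Set E3} (h : ∀ i ∈ s, conchoid O d (S i) ⊆ zariskiClosure S') :
    conchoid O d (⋃ i ∈ s, S i) ⊆ zariskiClosure S' := by
  refine zariskiClosure_subset_iff.2 ?_
  rintro Q ⟨P, hP, hQ⟩
  obtain ⟨i, hi, hPi⟩ := Set.mem_iUnion₂.1 hP
  exact h i hi (subset_zariskiClosure _ ⟨P, hPi, hQ⟩)

theorem zariskiClosure_iUnion_zariskiClosure {ι : Type*} (s : Set ι) (S : ι → Set E3) :
    zariskiClosure (⋃ i ∈ s, zariskiClosure (S i)) = zariskiClosure (⋃ i ∈ s, S i) := by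
  apply subset_antisymm
  · exact zariskiClosure_subset_iff.2 (Set.iUnion₂_subset fun i hi =>
      zariskiClosure_mono (Set.subset_biUnion_of_mem (u := S) hi))
  · exact zariskiClosure_mono (Set.iUnion₂_mono fun i _ => subset_zariskiClosure (S i))

theorem conchoid_pedalSurface {c e : Fin 3 → RatFunc ℝ} {O : E3} {T : Set ℝ}
    (hgood : ∀ u, u ∉ T → IsGood c e O u) (d : ℝ) :
    conchoid O d (zariskiClosure (⋃ u ∈ Tᶜ, rulingCurve c e O 0 u)) =
      zariskiClosure (⋃ u ∈ Tᶜ, rulingCurve c e O d u) := by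
  apply subset_antisymm
  · refine conchoid_zariskiClosure_subset (conchoid_iUnion_subset fun u hu => ?_)
    rw [(hgood u hu).conchoid_rulingCurve]
    exact zariskiClosure_mono (Set.subset_biUnion_of_mem (u := fun u => rulingCurve c e O d u) hu)
  · refine zariskiClosure_subset_iff.2 (Set.iUnion₂_subset fun u hu => ?_)
    exact ((hgood u hu).rulingCurve_subset_conchoid d).trans (conchoid_mono
      ((Set.subset_biUnion_of_mem (u := fun u => rulingCurve c e O 0 u) hu).trans
        (subset_zariskiClosure _)))

/-! ### Density of great circles in the sphere -/

theorem inner_cross_rotate (x y z : E3) : inner ℝ x (cross y z) = inner ℝ (cross x y) z := by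
  simp only [inner_eq, cross_apply_zero, cross_apply_one, cross_apply_two]; ring

/-- An analytic function that vanishes on the great circles orthogonal to a moving direction `g`
vanishes on the unit sphere. -/
theorem eq_zero_on_sphere {F : E3 → ℝ} (hF : AnalyticOnNhd ℝ F Set.univ) {g : ℝ → E3} {u₀ : ℝ}
    (hg : DifferentiableAt ℝ g u₀) (hB : cross (deriv g u₀) (g u₀) ≠ 0)
    (h : ∀ᶠ u in 𝓝 u₀, ∀ n : E3, ‖n‖ = 1 → inner ℝ n (g u) = 0 → F n = 0) {x : E3}
    (hx : ‖x‖ = 1) : F x = 0 := by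
  by_cases hxg : inner ℝ x (g u₀) = 0
  · exact h.self_of_nhds x hx hxg
  set b := cross (deriv g u₀) (g u₀) with hb
  -- The great circle orthogonal to w passes through x and meets the circle orthogonal to g(u) at
  -- z(u) = w × g(u), normalized. Projecting b along x gives ⟨w, b⟩ = |w|² ≠ 0, which makes these
  -- intersection points move with u.
  set w := b - (inner ℝ b x : ℝ) • x with hw
  have hxx : inner ℝ x x = (1 : ℝ) := by rw [real_inner_self_eq_norm_sq, hx]; norm_num
  have hwx : inner ℝ w x = 0 := by
    rw [hw, inner_sub_left, inner_smul_left, hxx]; simp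
  have hw0 : w ≠ 0 := by
    intro h0
    have h1 : b = (inner ℝ b x : ℝ) • x := sub_eq_zero.1 h0
    have h2 : inner ℝ b x ≠ (0 : ℝ) := by
      intro h2; rw [h2, zero_smul] at h1; exact hB h1
    have h3 : inner ℝ b (g u₀) = 0 := inner_cross_right _ _
    rw [h1, inner_smul_left, mul_eq_zero] at h3
    exact h3.elim h2 hxg
  have hwb : inner ℝ w b ≠ (0 : ℝ) := by
    have : inner ℝ w b = inner ℝ w w := by
      conv_rhs => rw [hw, inner_sub_right, inner_smul_right, ← hw, hwx]
      simp
    rw [this]; exact inner_self_ne_zero.2 hw0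
  have hk0 : cross w (g u₀) ≠ 0 := by
    intro h0
    apply hwb
    have : inner ℝ w b = - inner ℝ (deriv g u₀) (cross w (g u₀)) := by
      simp only [hb, inner_eq, cross_apply_zero, cross_apply_one, cross_apply_two]; ring
    rw [this, h0, inner_zero_right, neg_zero]
  set k : ℝ → E3 := fun u => cross w (g u) with hk
  have hkd : DifferentiableAt ℝ k u₀ := differentiableAt_cross (differentiableAt_const w) hg
  set z : ℝ → E3 := fun u => ‖k u‖⁻¹ • k u with hz
  have hzc : ContinuousAt z u₀ :=
    (hkd.continuousAt.norm.inv₀ (norm_ne_zero_iff.2 hk0)).smul hkd.continuousAt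
  have hkne : ∀ᶠ u in 𝓝 u₀, k u ≠ 0 := hkd.continuousAt.eventually_ne hk0
  -- The derivative of this function at u₀ is ⟨w, b⟩ ≠ 0. So near u₀, off u₀ itself, z(u) is not
  -- orthogonal to g(u₀), whereas z(u₀) is; hence z(u) ≠ z(u₀).
  have hscal : ∀ᶠ u in 𝓝[≠] u₀, inner ℝ w (cross (g u) (g u₀)) ≠ (0 : ℝ) := by
    have hlin : ∀ y : E3, inner ℝ w (cross y (g u₀)) = inner ℝ (cross (g u₀) w) y := by
      intro y
      simp only [inner_eq, cross_apply_zero, cross_apply_one, cross_apply_two]; ring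
    have hd : HasDerivAt (fun u => inner ℝ w (cross (g u) (g u₀))) (inner ℝ w b) u₀ := by
      simp only [hlin, hb]
      exact (innerSL ℝ (cross (g u₀) w)).hasFDerivAt.comp_hasDerivAt u₀ hg.hasDerivAt
    have := hd.eventually_ne hwb (c := 0)
    simpa using this
  have hzt : Tendsto z (𝓝[≠] u₀) (𝓝[≠] (z u₀)) := by
    refine tendsto_nhdsWithin_of_tendsto_nhds_of_eventually_within _
      (hzc.tendsto.mono_left nhdsWithin_le_nhds) ?_
    filter_upwards [hscal, hkne.filter_mono nhdsWithin_le_nhds] with u hu hku heq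
    apply hu
    have h1 : k u = ‖k u‖ • z u₀ := by
      rw [← (heq : z u = z u₀), hz]
      simp only
      rw [smul_inv_smul₀ (norm_ne_zero_iff.2 hku)]
    rw [inner_cross_rotate]
    change inner ℝ (k u) (g u₀) = 0
    rw [h1, hz]
    simp only
    rw [inner_smul_left, inner_smul_left, inner_cross_right]; simp
  -- As z(u) tends to z(u₀) without attaining it, it leaves every finite set, yet F vanishes at
  -- z(u).
  have hinf : {n : E3 | ‖n‖ = 1 ∧ inner ℝ n w = 0 ∧ F n = 0}.Infinite := by
    intro hfin
    have h1 := hzt.eventually (nhdsNE_le_cofinite _ hfin.eventually_cofinite_notMem)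
    have h2 := (h.and hkne).filter_mono (nhdsWithin_le_nhds (s := {u₀}ᶜ))
    obtain ⟨u, h3, h4, h5⟩ := (h1.and h2).exists
    have hnz : ‖z u‖ = 1 := by
      rw [hz]; simp only
      rw [norm_smul, norm_inv, norm_norm, inv_mul_cancel₀ (norm_ne_zero_iff.2 h5)]
    refine h3 ⟨hnz, ?_, h4 _ hnz ?_⟩
    · rw [hz]; simp only
      rw [inner_smul_left, inner_cross_left, mul_zero]
    · rw [hz]; simp only
      rw [inner_smul_left, inner_cross_right, mul_zero]
  exact eq_zero_on_great_circle hF hw0 hinf (fun n hn => hn) hx (by rw [real_inner_comm, hwx])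

/-! ### The rational polar representation -/

/-- The unit vectors orthogonal to `q`, in terms of one of them, `ω⁻¹ n`. -/
noncomputable def polarDir (n q : E3) (ω t : ℝ) : E3 :=
  (ω * (1 + ‖q‖ ^ 2 * t ^ 2))⁻¹ • ((1 - ‖q‖ ^ 2 * t ^ 2) • n + (2 * t) • cross q n)

section

variable {n q : E3} {ω : ℝ}

theorem norm_polarDir (hω : ω ≠ 0) (hn : ‖n‖ ^ 2 = ω ^ 2) (hq : inner ℝ n q = 0) (t : ℝ) :
    ‖polarDir n q ω t‖ = 1 := by
  have h1 : 0 < 1 + ‖q‖ ^ 2 * t ^ 2 := by positivity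
  have h2 : ‖polarDir n q ω t‖ ^ 2 = 1 := by
    have hx : inner ℝ n (cross q n) = 0 := by rw [real_inner_comm, inner_cross_right]
    rw [polarDir, norm_smul, mul_pow, norm_add_sq_real, inner_smul_left, inner_smul_right, hx,
      norm_smul, norm_smul, mul_pow, mul_pow, norm_cross_sq, real_inner_comm, hq, hn]
    simp only [Real.norm_eq_abs, sq_abs, conj_trivial]
    field_simp
    ring
  exact (pow_eq_one_iff_of_nonneg (norm_nonneg _) two_ne_zero).1 h2

theorem inner_polarDir (hq : inner ℝ n q = 0) (t : ℝ) : inner ℝ (polarDir n q ω t) q = 0 := by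
  rw [polarDir, inner_smul_left, inner_add_left, inner_smul_left, inner_smul_left, hq,
    inner_cross_left]
  simp

/-- With τ = ‖q‖ t = tan(φ/2), the coefficients are cos φ and sin φ of a rotation about q; using
‖q‖² keeps them rational. The parameter is recovered from tan(φ/2) = sin φ / (1 + cos φ), which is
the relation B = t ‖q‖² (A + ω) below. -/
theorem polarDir_injective (hω : ω ≠ 0) (hn : ‖n‖ ^ 2 = ω ^ 2) (hq : inner ℝ n q = 0)
    (hq0 : q ≠ 0) : Function.Injective (polarDir n q ω) := by
  have hq1 : ‖q‖ ^ 2 ≠ 0 := pow_ne_zero 2 (norm_ne_zero_iff.2 hq0)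
  have h1 : ∀ t, inner ℝ (polarDir n q ω t) n * (1 + ‖q‖ ^ 2 * t ^ 2) =
      ω * (1 - ‖q‖ ^ 2 * t ^ 2) := by
    intro t
    have : 0 < 1 + ‖q‖ ^ 2 * t ^ 2 := by positivity
    rw [polarDir, inner_smul_left, inner_add_left, inner_smul_left, inner_smul_left,
      inner_cross_right, real_inner_self_eq_norm_sq, hn]
    simp only [conj_trivial]
    field_simp
    ring
  have h2 : ∀ t, inner ℝ (polarDir n q ω t) (cross q n) * (1 + ‖q‖ ^ 2 * t ^ 2) =
      2 * t * ‖q‖ ^ 2 * ω := by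
    intro t
    have : 0 < 1 + ‖q‖ ^ 2 * t ^ 2 := by positivity
    have hx : inner ℝ n (cross q n) = 0 := by rw [real_inner_comm, inner_cross_right]
    rw [polarDir, inner_smul_left, inner_add_left, inner_smul_left, inner_smul_left, hx,
      real_inner_self_eq_norm_sq, norm_cross_sq, real_inner_comm, hq, hn]
    simp only [conj_trivial]
    field_simp
    ring
  intro t t' htt
  have a1 := h1 t
  have a2 := h1 t'
  have b1 := h2 t
  have b2 := h2 t'
  rw [htt] at a1 b1
  set A := inner ℝ (polarDir n q ω t') n
  set B := inner ℝ (polarDir n q ω t') (cross q n)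
  have hA : (A + ω) * (1 + ‖q‖ ^ 2 * t' ^ 2) = 2 * ω := by linear_combination a2
  have hA0 : A + ω ≠ 0 := by
    intro h0; rw [h0, zero_mul] at hA; exact hω (by linarith)
  have key : ∀ s : ℝ, A * (1 + ‖q‖ ^ 2 * s ^ 2) = ω * (1 - ‖q‖ ^ 2 * s ^ 2) →
      B * (1 + ‖q‖ ^ 2 * s ^ 2) = 2 * s * ‖q‖ ^ 2 * ω → B = s * ‖q‖ ^ 2 * (A + ω) := by
    intro s c1 c2
    have hs : 1 + ‖q‖ ^ 2 * s ^ 2 ≠ 0 := by positivity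
    apply mul_right_cancel₀ hs
    linear_combination c2 - s * ‖q‖ ^ 2 * c1
  have h3 := (key t a1 b1).symm.trans (key t' a2 b2)
  exact mul_right_cancel₀ hq1 (mul_right_cancel₀ hA0 h3)

end

/-- The value of a triple of polynomials. -/
noncomputable def polyVec (P : Fin 3 → ℝ[X]) (u : ℝ) : E3 := WithLp.toLp 2 fun i => (P i).eval u

/-- Orthogonality to e depends only on its direction, so e may be replaced by a polynomial multiple,
to which the two-square theorem applies. -/
theorem exists_common_denominator (c : Fin 3 → RatFunc ℝ) :
    ∃ (D : ℝ[X]) (P : Fin 3 → ℝ[X]), D ≠ 0 ∧ ∀ u, D.eval u ≠ 0 →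
      (∀ i, IsDefinedAt (c i) u) ∧ D.eval u • curveAt c u = polyVec P u := by
  have hdvd : ∀ i, (c i).denom ∣ ∏ j, (c j).denom := fun i =>
    Finset.dvd_prod_of_mem _ (Finset.mem_univ i)
  choose k hk using hdvd
  refine ⟨∏ j, (c j).denom, fun i => (c i).num * k i,
    Finset.prod_ne_zero_iff.2 fun j _ => (c j).denom_ne_zero, fun u hu => ?_⟩
  have hdef : ∀ i, IsDefinedAt (c i) u := by
    intro i h0
    apply hu
    rw [hk i, eval_mul, h0, zero_mul]
  refine ⟨hdef, ?_⟩
  ext i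
  have hi : (c i).denom.eval u ≠ 0 := hdef i
  simp only [PiLp.smul_apply, curveAt, polyVec, smul_eq_mul, ratFunc_eval_eq, eval_mul]
  rw [hk i, eval_mul]
  field_simp

/-- A polynomial in the first of two variables. -/
noncomputable def inFirst (p : ℝ[X]) : MvPolynomial (Fin 2) ℝ :=
  Polynomial.aeval (MvPolynomial.X 0) p

@[simp] theorem eval_inFirst (p : ℝ[X]) (a : Fin 2 → ℝ) :
    MvPolynomial.eval a (inFirst p) = p.eval (a 0) := by
  have := Polynomial.aeval_algHom_apply (MvPolynomial.aeval (R := ℝ) a)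
    (MvPolynomial.X 0 : MvPolynomial (Fin 2) ℝ) p
  simpa [MvPolynomial.aeval_eq_eval, inFirst, Polynomial.coe_aeval_eq_eval] using this.symm

section

variable (N Q : Fin 3 → ℝ[X]) (ω : ℝ[X])

/-- The common denominator of the rational direction field. -/
noncomputable def polarDen : MvPolynomial (Fin 2) ℝ :=
  inFirst ω * (1 + inFirst (Q 0 ^ 2 + Q 1 ^ 2 + Q 2 ^ 2) * MvPolynomial.X 1 ^ 2)

/-- The numerators of the rational direction field. -/
noncomputable def polarNum (i : Fin 3) : MvPolynomial (Fin 2) ℝ :=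
  (1 - inFirst (Q 0 ^ 2 + Q 1 ^ 2 + Q 2 ^ 2) * MvPolynomial.X 1 ^ 2) * inFirst (N i) +
    2 * MvPolynomial.X 1 * inFirst (crossProduct Q N i)

variable {N Q ω}

theorem norm_polyVec_sq (u : ℝ) :
    ‖polyVec Q u‖ ^ 2 = (Q 0 ^ 2 + Q 1 ^ 2 + Q 2 ^ 2).eval u := by
  simp [norm_sq_eq, polyVec]

theorem inner_polyVec (u : ℝ) :
    inner ℝ (polyVec N u) (polyVec Q u) = (N 0 * Q 0 + N 1 * Q 1 + N 2 * Q 2).eval u := by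
  simp [inner_eq, polyVec]

theorem eval_polarDen (a : Fin 2 → ℝ) :
    MvPolynomial.eval a (polarDen Q ω) = ω.eval (a 0) * (1 + ‖polyVec Q (a 0)‖ ^ 2 * a 1 ^ 2) := by
  rw [norm_polyVec_sq, polarDen]; simp

/-- The half-angle factor is positive over the reals, so poles depend on u alone and whole rulings
are either admitted or excluded. -/
theorem eval_polarDen_ne_zero {a : Fin 2 → ℝ} :
    MvPolynomial.eval a (polarDen Q ω) ≠ 0 ↔ ω.eval (a 0) ≠ 0 := by
  have : 1 + ‖polyVec Q (a 0)‖ ^ 2 * a 1 ^ 2 ≠ 0 := by positivity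
  rw [eval_polarDen, mul_ne_zero_iff]
  exact and_iff_left this

theorem polarDen_ne_zero (hω : ω ≠ 0) : polarDen Q ω ≠ 0 := by
  obtain ⟨u, hu⟩ := (eventually_eval_ne_zero hω).exists
  intro h
  have := (eval_polarDen_ne_zero (Q := Q) (a := ![u, 0])).2 hu
  rw [h, map_zero] at this
  exact this rfl

theorem eval_polarNum (a : Fin 2 → ℝ) (i : Fin 3) :
    MvPolynomial.eval a (polarNum N Q i) = ((1 - ‖polyVec Q (a 0)‖ ^ 2 * a 1 ^ 2) • polyVec N (a 0) +
      (2 * a 1) • cross (polyVec Q (a 0)) (polyVec N (a 0))) i := by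
  rw [norm_polyVec_sq, polarNum]
  fin_cases i <;> simp [polyVec, cross_apply]

/-- The rational direction field of the polar representation. -/
noncomputable def polarField (N Q : Fin 3 → ℝ[X]) (hω : ω ≠ 0) (i : Fin 3) : RatFun2 where
  num := polarNum N Q i
  den := polarDen Q ω
  den_ne_zero := polarDen_ne_zero hω

theorem polarField_isDefinedAt (hω : ω ≠ 0) (a : Fin 2 → ℝ) :
    (∀ i, (polarField N Q hω i).IsDefinedAt a) ↔ ω.eval (a 0) ≠ 0 :=
  ⟨fun h => eval_polarDen_ne_zero.1 (h 0), fun h _ => eval_polarDen_ne_zero.2 h⟩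

theorem val3_polarField (hω : ω ≠ 0) (a : Fin 2 → ℝ) :
    val3 (polarField N Q hω) a = polarDir (polyVec N (a 0)) (polyVec Q (a 0)) (ω.eval (a 0)) (a 1) := by
  ext i
  simp only [val3, RatFun2.val, polarField, polarDir]
  rw [eval_polarNum, eval_polarDen, PiLp.smul_apply, smul_eq_mul, div_eq_inv_mul]

/-- The rational radius function of the polar representation. -/
noncomputable def polarRadius (O : E3) (P N Q : Fin 3 → ℝ[X]) {D : ℝ[X]} (hD : D ≠ 0)
    (hω : ω ≠ 0) : RatFun2 where
  num := ∑ i, (inFirst (P i) - MvPolynomial.C (O i) * inFirst D) * polarNum N Q i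
  den := inFirst D * polarDen Q ω
  den_ne_zero := mul_ne_zero
    (by
      obtain ⟨u, hu⟩ := (eventually_eval_ne_zero hD).exists
      intro h
      have := eval_inFirst D ![u, 0]
      rw [h, map_zero] at this
      exact hu this.symm)
    (polarDen_ne_zero hω)

theorem polarRadius_isDefinedAt {O : E3} {P : Fin 3 → ℝ[X]} {D : ℝ[X]} (hD : D ≠ 0) (hω : ω ≠ 0)
    (a : Fin 2 → ℝ) :
    (polarRadius O P N Q hD hω).IsDefinedAt a ↔ D.eval (a 0) ≠ 0 ∧ ω.eval (a 0) ≠ 0 := by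
  rw [RatFun2.IsDefinedAt, polarRadius, map_mul, mul_ne_zero_iff, eval_inFirst,
    eval_polarDen_ne_zero]

theorem polarRadius_val {O x : E3} {P : Fin 3 → ℝ[X]} {D : ℝ[X]} (hD : D ≠ 0) (hω : ω ≠ 0)
    {a : Fin 2 → ℝ} (h0 : D.eval (a 0) ≠ 0) (hx : D.eval (a 0) • x = polyVec P (a 0)) :
    (polarRadius O P N Q hD hω).val a = inner ℝ (x - O) (val3 (polarField N Q hω) a) := by
  have hP : ∀ i, (P i).eval (a 0) = D.eval (a 0) * x i := fun i =>
    (congrArg (fun y : E3 => y i) hx).symm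
  rw [inner_eq]
  simp only [RatFun2.val, polarRadius, val3, polarField, map_mul, map_add, map_sub, eval_inFirst,
    MvPolynomial.eval_C, hP, Fin.sum_univ_three, PiLp.sub_apply]
  rw [← mul_div_assoc, ← mul_div_assoc, ← mul_div_assoc, ← add_div, ← add_div,
    ← mul_div_mul_left _ (MvPolynomial.eval a (polarDen Q ω)) h0]
  congr 1
  ring

end

theorem RatFun2.addConst_val {r : RatFun2} {a : Fin 2 → ℝ} (h : r.IsDefinedAt a) (d : ℝ) :
    (r.addConst d).val a = r.val a + d := by
  have h' : MvPolynomial.eval a r.den ≠ 0 := h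
  simp only [RatFun2.val, RatFun2.addConst, map_add, map_mul, MvPolynomial.eval_C]
  field_simp

theorem RatFun2.continuousAt_val {r : RatFun2} {u t : ℝ} (h : r.IsDefinedAt ![u, t]) :
    ContinuousAt (fun x => r.val ![x, t]) u := by
  have hv : Continuous fun x : ℝ => ![x, t] := by
    refine continuous_pi fun i => ?_
    fin_cases i
    · exact continuous_id
    · exact continuous_const
  exact ((MvPolynomial.continuous_eval r.num).comp hv).continuousAt.div
    ((MvPolynomial.continuous_eval r.den).comp hv).continuousAt h

theorem continuousAt_val3 {s : Fin 3 → RatFun2} {u t : ℝ} (h : ∀ i, (s i).IsDefinedAt ![u, t]) :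
    ContinuousAt (fun x => val3 s ![x, t]) u :=
  (PiLp.continuous_toLp 2 _).continuousAt.comp
    (continuousAt_pi.2 fun i => RatFun2.continuousAt_val (h i))

theorem continuousAt_polar (O : E3) {r : RatFun2} {s : Fin 3 → RatFun2} {u t : ℝ}
    (hs : ∀ i, (s i).IsDefinedAt ![u, t]) (hr : r.IsDefinedAt ![u, t]) :
    ContinuousAt (fun x => O + r.val ![x, t] • val3 s ![x, t]) u := by
  have h1 : ContinuousAt (fun x => r.val ![x, t] • val3 s ![x, t]) u :=
    (RatFun2.continuousAt_val hr).smul (continuousAt_val3 hs)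
  exact continuousAt_const.add h1

theorem zariskiClosure_subset_sphere {S : Set E3} (h : ∀ x ∈ S, ‖x‖ = 1) :
    zariskiClosure S ⊆ Metric.sphere 0 1 := by
  intro x hx
  have := hx (MvPolynomial.X 0 ^ 2 + MvPolynomial.X 1 ^ 2 + MvPolynomial.X 2 ^ 2 - 1) fun y hy => by
    have h1 := norm_sq_eq y
    rw [h y hy] at h1
    simp only [map_sub, map_add, map_pow, MvPolynomial.eval_X, map_one, ← h1]
    norm_num
  simp only [map_sub, map_add, map_pow, MvPolynomial.eval_X, map_one, ← norm_sq_eq] at this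
  rw [mem_sphere_zero_iff_norm]
  exact (pow_eq_one_iff_of_nonneg (norm_nonneg _) two_ne_zero).1 (sub_eq_zero.1 this)

/-- A criterion for polar representations: almost everywhere, `s(u, ·)` runs through infinitely many
unit normals of the ruled surface along the ruling `u`, and `r` is the support function. -/
theorem isRationalPolarRepresentation_of_normals {c e : Fin 3 → RatFunc ℝ} {O : E3} {T : Set ℝ}
    (hT : T.Finite) (hgood : ∀ u, u ∉ T → IsGood c e O u) {r : RatFun2} {s : Fin 3 → RatFun2}
    (hnorm : ∀ a, (∀ i, (s i).IsDefinedAt a) → ‖val3 s a‖ = 1)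
    (hsdef : ∀ u, u ∉ T → ∀ t i, (s i).IsDefinedAt ![u, t])
    (hrdef : ∀ u, u ∉ T → ∀ t, r.IsDefinedAt ![u, t])
    (hperp : ∀ u, u ∉ T → ∀ t, inner ℝ (val3 s ![u, t]) (curveAt e u) = 0)
    (hr : ∀ u, u ∉ T → ∀ t, r.val ![u, t] = inner ℝ (curveAt c u - O) (val3 s ![u, t]))
    (hinf : ∀ u, u ∉ T → (Set.range fun t => val3 s ![u, t]).Infinite) (d : ℝ) :
    IsRationalPolarRepresentation O (r.addConst d) s
      (pedalSurface O (offset (ruled c e) d) (ruledDomain c e)) := by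
  have hTev : ∀ᶠ u in cofinite, u ∉ T := hT.eventually_cofinite_notMem
  refine ⟨hnorm, subset_antisymm ?_ ?_, ?_⟩
  · refine zariskiClosure_subset_sphere ?_
    rintro x ⟨a, ha, rfl⟩
    exact hnorm a ha
  · intro x hx p hp
    -- Vanishing on infinitely many s(u, t) spreads over the great circle orthogonal to e(u);
    -- letting u vary near u₀ then covers the sphere.
    obtain ⟨u₀, hu₀, hu₀T⟩ := ((eventually_eventually_nhds hTev).and hTev).exists
    have hg₀ := hgood u₀ hu₀T
    refine eq_zero_on_sphere (analyticOnNhd_eval p)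
      (differentiableAt_curveAt fun i => (hg₀.mem_base i).2) hg₀.crossC_self_ne_zero ?_
      (mem_sphere_zero_iff_norm.1 hx)
    filter_upwards [hu₀] with u hu n hn hne
    refine eq_zero_on_great_circle (analyticOnNhd_eval p) (hgood u hu).direction_ne_zero
      (hinf u hu) ?_ hn hne
    rintro _ ⟨t, rfl⟩
    exact ⟨hnorm _ (hsdef u hu t), hperp u hu t, hp _ ⟨![u, t], hsdef u hu t, rfl⟩⟩
  · have hval : ∀ u, u ∉ T → ∀ t, O + (r.addConst d).val ![u, t] • val3 s ![u, t] =
        footAt O (curveAt c u) d (val3 s ![u, t]) := by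
      intro u hu t
      rw [RatFun2.addConst_val (hrdef u hu t), hr u hu t, footAt]
    rw [pedalSurface_offset_eq hT hgood]
    apply subset_antisymm
    · refine zariskiClosure_subset_iff.2 ?_
      rintro x ⟨a, ha, hra, rfl⟩
      obtain ⟨u₀, t, rfl⟩ : ∃ u₀ t, a = ![u₀, t] :=
        ⟨a 0, a 1, by ext i; fin_cases i <;> rfl⟩
      -- The representation may be defined at parameters in `T`; such points are limits with t
      -- fixed.
      have hcont := continuousAt_polar O (r := r.addConst d) (s := s) ha hra
      have hlim : ∀ᶠ u in 𝓝[≠] u₀, O + (r.addConst d).val ![u, t] • val3 s ![u, t] ∈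
          zariskiClosure (⋃ u ∈ Tᶜ, rulingCurve c e O d u) := by
        filter_upwards [eventually_nhdsNE_of_cofinite hTev u₀] with u hu
        rw [hval u hu t]
        exact subset_zariskiClosure _ (Set.mem_biUnion (x := u) hu
          ⟨_, hnorm _ (hsdef u hu t), hperp u hu t, rfl⟩)
      have hmem := mem_zariskiClosure_of_eventually hcont hlim
      exact hmem
    · refine zariskiClosure_subset_iff.2 (Set.iUnion₂_subset fun u hu => ?_)
      refine footCurve_subset_zariskiClosure (hgood u hu).direction_ne_zero (hinf u hu) ?_ ?_
      · rintro _ ⟨t, rfl⟩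
        exact ⟨hnorm _ (hsdef u hu t), hperp u hu t⟩
      · rintro _ ⟨t, rfl⟩
        exact subset_zariskiClosure _ ⟨![u, t], hsdef u hu t, hrdef u hu t, (hval u hu t).symm⟩

theorem exists_rationalPolarRepresentation {c e : Fin 3 → RatFunc ℝ} (hF : ¬ IsDevelopable c e)
    (O : E3) :
    ∃ (r : RatFun2) (s : Fin 3 → RatFun2), ∀ d : ℝ,
      IsRationalPolarRepresentation O (r.addConst d) s
        (pedalSurface O (offset (ruled c e) d) (ruledDomain c e)) := by
  obtain ⟨D, P, hD, hDP⟩ := exists_common_denominator c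
  obtain ⟨D', Q, hD', hDQ⟩ := exists_common_denominator e
  obtain ⟨N, ω, hω, hN, hNQ⟩ := exists_orthogonal_with_polynomial_length Q
  have hN' : ∀ u, ‖polyVec N u‖ ^ 2 = ω.eval u ^ 2 := fun u => by
    rw [norm_polyVec_sq, hN, eval_pow]
  have hNQ' : ∀ u, inner ℝ (polyVec N u) (polyVec Q u) = 0 := fun u => by
    rw [inner_polyVec, hNQ, eval_zero]
  obtain ⟨T, hT, hgood⟩ := exists_finite_of_eventually_cofinite
    ((eventually_isGood hF O).and ((eventually_eval_ne_zero hD).and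
      ((eventually_eval_ne_zero hD').and (eventually_eval_ne_zero hω))))
  have hv : ∀ u t, val3 (polarField N Q hω) ![u, t] =
      polarDir (polyVec N u) (polyVec Q u) (ω.eval u) t := fun u t => val3_polarField hω ![u, t]
  refine ⟨polarRadius O P N Q hD hω, polarField N Q hω,
    isRationalPolarRepresentation_of_normals hT (fun u hu => (hgood u hu).1) ?_ ?_ ?_ ?_ ?_ ?_⟩
  · intro a ha
    rw [val3_polarField]
    exact norm_polarDir ((polarField_isDefinedAt hω a).1 ha) (hN' _) (hNQ' _) _
  · intro u hu t
    exact (polarField_isDefinedAt hω ![u, t]).2 (hgood u hu).2.2.2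
  · intro u hu t
    exact (polarRadius_isDefinedAt hD hω ![u, t]).2 ⟨(hgood u hu).2.1, (hgood u hu).2.2.2⟩
  · intro u hu t
    obtain ⟨-, -, h3, -⟩ := hgood u hu
    have h := inner_polarDir (ω := ω.eval u) (hNQ' u) t
    rw [← (hDQ u h3).2, inner_smul_right, mul_eq_zero, (hDQ u h3).2, ← hv] at h
    exact h.resolve_left h3
  · intro u hu t
    obtain ⟨-, h2, -, -⟩ := hgood u hu
    exact polarRadius_val hD hω (a := ![u, t]) h2 (hDP u h2).2
  · intro u hu
    obtain ⟨h1, -, h3, h4⟩ := hgood u hu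
    simp only [hv]
    refine Set.infinite_range_of_injective (polarDir_injective h4 (hN' u) (hNQ' u) ?_)
    rw [← (hDQ u h3).2]
    exact smul_ne_zero h3 h1.direction_ne_zero

end RuledPedal

theorem mainTheorem4 (c e : Fin 3 → RatFunc ℝ) (hF : ¬ RuledPedal.IsDevelopable c e)
    (O : RuledPedal.E3) :
    -- the pedal surfaces of all offsets have rational polar representations `O + (r + d) s`
    (∃ (r : RuledPedal.RatFun2) (s : Fin 3 → RuledPedal.RatFun2), ∀ d : ℝ,
      RuledPedal.IsRationalPolarRepresentation O (r.addConst d) s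
        (RuledPedal.pedalSurface O (RuledPedal.offset (RuledPedal.ruled c e) d)
          (RuledPedal.ruledDomain c e))) ∧
    -- the rational family of circles, with centres `m(u)` and squared radii `q(u)`
    (∃ (m : Fin 3 → RatFunc ℝ) (q : RatFunc ℝ) (T : Set ℝ), T.Finite ∧
      (∀ u, u ∉ T →
        u ∈ RuledPedal.ruledBase c e ∧
        (∀ i, RuledPedal.IsDefinedAt (m i) u) ∧ RuledPedal.IsDefinedAt q u ∧
        RuledPedal.curveAt e u ≠ 0 ∧
        0 < q.eval (RingHom.id ℝ) u ∧
        inner ℝ (O - RuledPedal.curveAt m u) (RuledPedal.curveAt e u) = 0 ∧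
        closure (RuledPedal.pedalSet O (RuledPedal.ruled c e)
            (RuledPedal.rulingDomain c e u)) =
          RuledPedal.circle (RuledPedal.curveAt m u) (q.eval (RingHom.id ℝ) u)
            (RuledPedal.curveAt e u) ∧
        ∀ d : ℝ,
          RuledPedal.zariskiClosure
              (RuledPedal.pedalSet O (RuledPedal.offset (RuledPedal.ruled c e) d)
                (RuledPedal.rulingDomain c e u)) =
            RuledPedal.conchoid O d
              (RuledPedal.circle (RuledPedal.curveAt m u) (q.eval (RingHom.id ℝ) u)
                (RuledPedal.curveAt e u))) ∧
      RuledPedal.pedalSurface O (RuledPedal.ruled c e) (RuledPedal.ruledDomain c e) =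
        RuledPedal.zariskiClosure (⋃ u ∈ Tᶜ,
          RuledPedal.circle (RuledPedal.curveAt m u) (q.eval (RingHom.id ℝ) u)
            (RuledPedal.curveAt e u)) ∧
      ∀ d : ℝ,
        RuledPedal.pedalSurface O (RuledPedal.offset (RuledPedal.ruled c e) d)
            (RuledPedal.ruledDomain c e) =
          RuledPedal.zariskiClosure (⋃ u ∈ Tᶜ,
            RuledPedal.conchoid O d
              (RuledPedal.circle (RuledPedal.curveAt m u) (q.eval (RingHom.id ℝ) u)
                (RuledPedal.curveAt e u)))) ∧
    -- the pedal surface of the offset is the conchoid surface of the pedal surface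
    (∀ d : ℝ,
      RuledPedal.pedalSurface O (RuledPedal.offset (RuledPedal.ruled c e) d)
          (RuledPedal.ruledDomain c e) =
        RuledPedal.conchoid O d
          (RuledPedal.pedalSurface O (RuledPedal.ruled c e)
            (RuledPedal.ruledDomain c e))) := by
  refine ⟨RuledPedal.exists_rationalPolarRepresentation hF O, ?_, ?_⟩
  · have hperp := RuledPedal.isRationalCurve_perpPart c e O
    -- With w the projection of c - O orthogonal to e, the Thales circle has centre O + w/2 and
    -- squared radius |w|²/4. The finitely many parameters where the rational functions differ from
    -- these values are put into `T`.
    obtain ⟨m, hm⟩ := ((RuledPedal.IsRationalCurve.const O).add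
      (RuledPedal.IsRationalCurve.smul (RuledPedal.IsRational.const 2⁻¹) hperp)).exists_curveAt
    obtain ⟨q, hq⟩ := (hperp.inner hperp).div (RuledPedal.IsRational.const 4)
    simp only [real_inner_self_eq_norm_sq] at hq
    obtain ⟨T, hT, hgood⟩ := RuledPedal.exists_finite_of_eventually_cofinite
      ((RuledPedal.eventually_isGood hF O).and (hm.and (hq.and ((eventually_all.2
        fun i => RuledPedal.eventually_isDefinedAt (m i)).and
          (RuledPedal.eventually_isDefinedAt q)))))
    have hcircle : ∀ u, u ∉ T → RuledPedal.circle (RuledPedal.curveAt m u)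
        (q.eval (RingHom.id ℝ) u) (RuledPedal.curveAt e u) =
          RuledPedal.rulingCurve c e O 0 u := by
      intro u hu
      obtain ⟨h1, h2, h3, -⟩ := hgood u hu
      rw [h1.rulingCurve_zero, h2, ← h3]
    refine ⟨m, q, T, hT, fun u hu => ?_, ?_, fun d => ?_⟩
    · obtain ⟨h1, h2, h3, h4, h5⟩ := hgood u hu
      refine ⟨h1.mem_base, h4, h5, h1.direction_ne_zero, ?_, ?_, ?_, fun d => ?_⟩
      · rw [← h3]
        have := norm_pos_iff.2 h1.perp_ne_zero
        positivity
      · rw [h2, sub_add_cancel_left, inner_neg_left, inner_smul_left,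
          RuledPedal.inner_perpPart h1.direction_ne_zero, mul_zero, neg_zero]
      · rw [hcircle u hu, h1.closure_pedalSet]
      · rw [hcircle u hu, h1.zariskiClosure_pedalSet, h1.conchoid_rulingCurve]
    · have h := RuledPedal.pedalSurface_offset_eq hT (fun u hu => (hgood u hu).1) 0
      rw [RuledPedal.offset_zero] at h
      rw [h]
      exact congrArg _ (Set.iUnion₂_congr fun u hu => (hcircle u hu).symm)
    · rw [RuledPedal.pedalSurface_offset_eq hT (fun u hu => (hgood u hu).1),
        ← RuledPedal.zariskiClosure_iUnion_zariskiClosure]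
      refine congrArg _ (Set.iUnion₂_congr fun u hu => ?_)
      rw [hcircle u hu, (hgood u hu).1.conchoid_rulingCurve]
  · intro d
    obtain ⟨T, hT, hgood⟩ := RuledPedal.exists_finite_of_eventually_cofinite
      (RuledPedal.eventually_isGood hF O)
    have h := RuledPedal.pedalSurface_offset_eq hT hgood 0
    rw [RuledPedal.offset_zero] at h
    rw [h, RuledPedal.conchoid_pedalSurface hgood, RuledPedal.pedalSurface_offset_eq hT hgood]
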